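/- Let $A$ be a real symmetric positive definite $2\times2$ matrix with $\det A=1$, let $Q(\mathbf x)=\mathbf x A\mathbf x^{T}$ and $Q^{-1}(\mathbf x)=\mathbf x A^{-1}\mathbf x^{T}$ for $\mathbf x\in\mathbb R^2$, let $\mathcal E=\{\mathbf x\in\mathbb R^2: Q(\mathbf x)\le 1\}$, and let $g=\sqrt{Q^{-1}}$. For $t>0$ put $$P_f^{(2)}(t)=\#\left(t\mathcal E\cap\mathbb Z^2\right)-\pi t^2,$$ and let $$G_0=\min_{\mathbf 0\ne\mathbf k\in\mathbb Z^2} g(\mathbf k),\qquad G_1=\max_{\mathbf w\in[-\frac12,\frac12]^2} g(\mathbf w),\qquad a_g^{(2)}(u)=\pi(u+G_1)^2-1,$$ $$c=\frac16\left(\frac{2823576}{\pi^2}\right)^{1/9}=0.67317\ldots,\qquad \epsilon=\frac{c}{t^{1/3}},\qquad K=(3\pi)^{-2/3}\,\epsilon^{-1}.$$ Then for every real $t\ge 28\,G_0^3$, $$\left|P_f^{(2)}(t)\right|\le \pi\left((t+\epsilon)^2-t^2\right)+\frac{(t+\epsilon)^{1/2}}{3K^{3/2}}\,a_g^{(2)}(K)+\frac{(t+\epsilon)^{1/2}}{2}\int_{G_0}^{K}u^{-5/2}a_g^{(2)}(u)\,du+\frac{(t+\epsilon)^{1/2}}{3\pi\,\epsilon^{3/2}}\int_{K}^{\infty}u^{-4}a_g^{(2)}(u)\,du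 .\qquad(*)$$ In particular, for the circle, $P^{(2)}(t)=\#\{\mathbf m\in\mathbb Z^2: m_1^2+m_2^2\le t^2\}-\pi t^2$ satisfies, for every real $t\ge 28$, $$\left|P^{(2)}(t)\right|\le 8.46\,t^{2/3}+1.5\,t^{1/2}+1+\frac{3}{t^{1/3}}+\frac{2.85}{t^{2/3}}+\frac{0.51}{t^{5/6}}+\frac{0.34}{t^{4/3}} .$$ -/

import Mathlib

open scoped Pointwise Matrix

noncomputable section

namespace EllipseRest

/-- The binary quadratic form `Q(x) = x A xᵗ` with matrix `A`. -/
def quadForm (A : Matrix (Fin 2) (Fin 2) ℝ) (x : Fin 2 → ℝ) : ℝ := x ⬝ᵥ (A *ᵥ x)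

/-- The elliptic disc `Q ≤ 1`, where `Q` is the form with matrix `A`. -/
def ellipse (A : Matrix (Fin 2) (Fin 2) ℝ) : Set (Fin 2 → ℝ) := {x | quadForm A x ≤ 1}

/-- The unit disc `x₁² + x₂² ≤ 1`. -/
def unitDisc : Set (Fin 2 → ℝ) := {x | x 0 ^ 2 + x 1 ^ 2 ≤ 1}

/-- The integer vector `k`, seen as a real vector. -/
def toReal (k : Fin 2 → ℤ) : Fin 2 → ℝ := fun i => (k i : ℝ)

/-- The lattice points in the dilated domain `t B`, that is `t B ∩ ℤ²`. -/
def latticePoints (B : Set (Fin 2 → ℝ)) (t : ℝ) : Set (Fin 2 → ℤ) := {m | toReal m ∈ t • B}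

/-- The lattice rest `#(t B ∩ ℤ²) - π t²` of a domain `B` of area `π`. -/
def latticeRest (B : Set (Fin 2 → ℝ)) (t : ℝ) : ℝ :=
  ((latticePoints B t).ncard : ℝ) - Real.pi * t ^ 2

/-- The support function `g = √(Q⁻¹)` of the ellipse `Q ≤ 1`, where `Q⁻¹(x) = x A⁻¹ xᵗ`. -/
def supportFn (A : Matrix (Fin 2) (Fin 2) ℝ) (x : Fin 2 → ℝ) : ℝ := Real.sqrt (quadForm A⁻¹ x)

/-- The values of `g` at the nonzero lattice points. -/
def latticeValues (A : Matrix (Fin 2) (Fin 2) ℝ) : Set ℝ :=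
  {r | ∃ k : Fin 2 → ℤ, k ≠ 0 ∧ r = supportFn A (toReal k)}

/-- The values of `g` on the square `[-1/2, 1/2]²`. -/
def squareValues (A : Matrix (Fin 2) (Fin 2) ℝ) : Set ℝ :=
  {r | ∃ w : Fin 2 → ℝ, (∀ i, w i ∈ Set.Icc (-(1 / 2) : ℝ) (1 / 2)) ∧ r = supportFn A w}

/-- `G₀`, the minimum of `g` over the nonzero lattice points. -/
def minG (A : Matrix (Fin 2) (Fin 2) ℝ) : ℝ := sInf (latticeValues A)

/-- `G₁`, the maximum of `g` over the square `[-1/2, 1/2]²`. -/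
def maxG (A : Matrix (Fin 2) (Fin 2) ℝ) : ℝ := sSup (squareValues A)

/-- `a_g(u) = π (u + G₁)² - 1`. -/
def aFn (A : Matrix (Fin 2) (Fin 2) ℝ) (u : ℝ) : ℝ := Real.pi * (u + maxG A) ^ 2 - 1

/-- `c = (1/6) (2823576 / π²) ^ (1/9)`. -/
def cConst : ℝ := (1 / 6) * (2823576 / Real.pi ^ 2) ^ (1 / 9 : ℝ)

/-- `ε = c / t ^ (1/3)`. -/
def eps (t : ℝ) : ℝ := cConst / t ^ (1 / 3 : ℝ)

/-- `K = (3π) ^ (-2/3) ε⁻¹`. -/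
def bigK (t : ℝ) : ℝ := (3 * Real.pi) ^ (-(2 / 3) : ℝ) * (eps t)⁻¹

end EllipseRest

end

noncomputable section

namespace EllipseRest

open MeasureTheory Set Filter Topology

/-! The proof is smoothing plus Poisson summation. The convolution of the indicators of the small
ellipse `Q ≤ ε²` and of an ellipse of radius `R` is continuous with compact support. By the triangle
inequality for `√Q`, its sum over `ℤ²` is at least `πε²` times the lattice count of `tE` when `R = t
+ ε`, and at most that when `R = t - ε`. Poisson summation evaluates the sum: frequency zero gives
`πε² · πR²`, whence the term `π((t+ε)² - t²)`, and every other frequency gives the product of the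
Fourier transforms of the two ellipses.

Unimodular coordinates show that the transform of the ellipse of radius `r` at `k` is `(r/g(k))
J₁(2πr g(k))`. The uniform bound `√x |J₁(x)| ≤ √(2π)/3` (`mul_besselJ1_sq_le`), proved by power
series up to `x = 2` and by Sonine's monotone function beyond, turns this into `r^(1/2) g(k)^(-3/2)
/ 3`. For the small ellipse the area `πε²` is the better bound as long as `g(k) ≤ K`; `K` is exactly
the crossover. After division by `πε²` the error is at most `(R^(1/2)/3) ∑ g^(-3/2) min(1,
(K/g)^(3/2))`.

This sum is handled by Abel summation (`sum_le_weightIntegral`) against the number of nonzero `k`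
with `g(k) ≤ u`, which is at most `a_g(u)` by packing unit squares into the dual ellipse
(`card_le_aFn`). The summand is continuous at `g = K`, so no boundary term arises there: the term of
(*) with `a_g(K)` is nonnegative surplus. For the circle the integrals are explicit. -/

/-! ### The Bessel functions `J₀` and `J₁` -/

/-- The Bessel function `J₀`. -/
def besselJ0 (x : ℝ) : ℝ := Real.pi⁻¹ * ∫ θ in (0 : ℝ)..Real.pi, Real.cos (x * Real.cos θ)

/-- The Bessel function `J₁`. -/
def besselJ1 (x : ℝ) : ℝ :=
  Real.pi⁻¹ * ∫ θ in (0 : ℝ)..Real.pi, Real.cos θ * Real.sin (x * Real.cos θ)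

/-- Integration by parts. The nonnegative weight `sin² θ` lets pointwise bounds for the cosine pass
to `J₁`, and the explicit factor `x` cancels the division in the formula for `J₁'`. -/
theorem besselJ1_eq (x : ℝ) : besselJ1 x =
    x * (Real.pi⁻¹ * ∫ θ in (0 : ℝ)..Real.pi, Real.sin θ ^ 2 * Real.cos (x * Real.cos θ)) := by
  have h := intervalIntegral.integral_mul_deriv_eq_deriv_mul (a := 0) (b := Real.pi)
    (u := fun θ => Real.sin (x * Real.cos θ)) (v := Real.sin)
    (u' := fun θ => Real.cos (x * Real.cos θ) * (x * -Real.sin θ)) (v' := Real.cos)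
    (fun θ _ => ((Real.hasDerivAt_cos θ).const_mul x).sin) (fun θ _ => Real.hasDerivAt_sin θ)
    (Continuous.intervalIntegrable (by fun_prop) _ _)
    (Continuous.intervalIntegrable (by fun_prop) _ _)
  simp only [Real.sin_pi, Real.sin_zero, mul_zero, sub_zero, zero_sub] at h
  have h2 : ∫ θ in (0 : ℝ)..Real.pi, Real.cos θ * Real.sin (x * Real.cos θ) =
      x * ∫ θ in (0 : ℝ)..Real.pi, Real.sin θ ^ 2 * Real.cos (x * Real.cos θ) := by
    rw [← intervalIntegral.integral_const_mul]
    calc _ = ∫ θ in (0 : ℝ)..Real.pi, Real.sin (x * Real.cos θ) * Real.cos θ := by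
          simp_rw [mul_comm]
      _ = _ := by
          rw [h, ← intervalIntegral.integral_neg]
          refine intervalIntegral.integral_congr fun θ _ => ?_
          ring
  rw [besselJ1, h2]; ring

theorem hasDerivAt_integral_cos_mul (g w : ℝ → ℝ) (hg : Continuous g) (hw : Continuous w) (x : ℝ) :
    HasDerivAt (fun x => ∫ θ in (0 : ℝ)..Real.pi, w θ * Real.cos (x * g θ))
      (∫ θ in (0 : ℝ)..Real.pi, w θ * (-Real.sin (x * g θ) * g θ)) x := by
  refine (intervalIntegral.hasDerivAt_integral_of_dominated_loc_of_deriv_le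
    (F := fun x θ => w θ * Real.cos (x * g θ))
    (F' := fun x θ => w θ * (-Real.sin (x * g θ) * g θ)) (bound := fun θ => |w θ| * |g θ|)
    (s := univ) univ_mem ?_ ?_ ?_ ?_ ?_ ?_).2
  · exact Eventually.of_forall fun y => Continuous.aestronglyMeasurable (by fun_prop)
  · exact Continuous.intervalIntegrable (by fun_prop) _ _
  · exact Continuous.aestronglyMeasurable (by fun_prop)
  · refine Eventually.of_forall fun θ _ y _ => ?_
    rw [norm_mul, norm_mul, norm_neg, Real.norm_eq_abs, Real.norm_eq_abs, Real.norm_eq_abs]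
    have := Real.abs_sin_le_one (y * g θ)
    gcongr
    exact mul_le_of_le_one_left (abs_nonneg _) this
  · exact Continuous.intervalIntegrable (by fun_prop) _ _
  · refine Eventually.of_forall fun θ _ y _ => ?_
    simpa using (((hasDerivAt_id y).mul_const (g θ)).cos).const_mul (w θ)

theorem hasDerivAt_integral_sin_mul (g w : ℝ → ℝ) (hg : Continuous g) (hw : Continuous w) (x : ℝ) :
    HasDerivAt (fun x => ∫ θ in (0 : ℝ)..Real.pi, w θ * Real.sin (x * g θ))
      (∫ θ in (0 : ℝ)..Real.pi, w θ * (Real.cos (x * g θ) * g θ)) x := by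
  refine (intervalIntegral.hasDerivAt_integral_of_dominated_loc_of_deriv_le
    (F := fun x θ => w θ * Real.sin (x * g θ))
    (F' := fun x θ => w θ * (Real.cos (x * g θ) * g θ)) (bound := fun θ => |w θ| * |g θ|)
    (s := univ) univ_mem ?_ ?_ ?_ ?_ ?_ ?_).2
  · exact Eventually.of_forall fun y => Continuous.aestronglyMeasurable (by fun_prop)
  · exact Continuous.intervalIntegrable (by fun_prop) _ _
  · exact Continuous.aestronglyMeasurable (by fun_prop)
  · refine Eventually.of_forall fun θ _ y _ => ?_
    rw [norm_mul, norm_mul, Real.norm_eq_abs, Real.norm_eq_abs, Real.norm_eq_abs]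
    have := Real.abs_cos_le_one (y * g θ)
    gcongr
    exact mul_le_of_le_one_left (abs_nonneg _) this
  · exact Continuous.intervalIntegrable (by fun_prop) _ _
  · refine Eventually.of_forall fun θ _ y _ => ?_
    simpa using (((hasDerivAt_id y).mul_const (g θ)).sin).const_mul (w θ)

theorem hasDerivAt_besselJ0 (x : ℝ) : HasDerivAt besselJ0 (-besselJ1 x) x := by
  have h := (hasDerivAt_integral_cos_mul Real.cos (fun _ => 1) Real.continuous_cos
    continuous_const x).const_mul Real.pi⁻¹
  simp only [one_mul] at h
  have h' : HasDerivAt besselJ0 _ x := h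
  refine h'.congr_deriv ?_
  rw [besselJ1, ← mul_neg, ← intervalIntegral.integral_neg]
  congr 1
  refine intervalIntegral.integral_congr fun θ _ => ?_
  ring

theorem hasDerivAt_besselJ1 {x : ℝ} (hx : x ≠ 0) :
    HasDerivAt besselJ1 (besselJ0 x - besselJ1 x / x) x := by
  have h := (hasDerivAt_integral_sin_mul Real.cos Real.cos Real.continuous_cos
    Real.continuous_cos x).const_mul Real.pi⁻¹
  have h' : HasDerivAt besselJ1 _ x := h
  refine h'.congr_deriv ?_
  rw [besselJ1_eq, mul_div_cancel_left₀ _ hx, besselJ0, ← mul_sub,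
    ← intervalIntegral.integral_sub (Continuous.intervalIntegrable (by fun_prop) _ _)
      (Continuous.intervalIntegrable (by fun_prop) _ _)]
  congr 1
  refine intervalIntegral.integral_congr fun θ _ => ?_
  simp only [Real.sin_sq]; ring

/-- Sonine's function for `J₁`: it dominates `x J₁(x)²` and decreases. -/
def sonine (x : ℝ) : ℝ :=
  x * besselJ1 x ^ 2 + (x * besselJ0 x - besselJ1 x / 2) ^ 2 * (4 * x / (4 * x ^ 2 - 3))

/-- The function `y = √x J₁` solves `y'' + q y = 0` with `q = 1 - 3/(4x²)`, and `sonine` is `y² +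
y'²/q`. Its derivative is `-y'² q'/q²`, which is nonpositive because `q` increases. -/
theorem antitoneOn_sonine : AntitoneOn sonine (Ici 2) := by
  have hd : ∀ x : ℝ, 2 ≤ x → HasDerivAt sonine
      (-(24 * (x * besselJ0 x - besselJ1 x / 2) ^ 2 / (4 * x ^ 2 - 3) ^ 2)) x := by
    intro x hx
    have hx0 : x ≠ 0 := by positivity
    have hq : 4 * x ^ 2 - 3 ≠ 0 := by nlinarith
    have h0 := hasDerivAt_besselJ0 x
    have h1 := hasDerivAt_besselJ1 hx0
    have h : HasDerivAt sonine _ x := ((hasDerivAt_id x).mul (h1.pow 2)).add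
      (((((hasDerivAt_id x).mul h0).sub (h1.div_const 2)).pow 2).mul
        (((hasDerivAt_id x).const_mul 4).div
          ((((hasDerivAt_id x).pow 2).const_mul 4).sub_const 3) hq))
    refine h.congr_deriv ?_
    simp only [id_eq, Pi.pow_apply, Pi.mul_apply, Pi.sub_apply, Nat.cast_ofNat]
    obtain ⟨D, hD⟩ : ∃ D, D = 4 * x ^ 2 - 3 := ⟨_, rfl⟩
    rw [← hD] at hq ⊢
    field_simp
    rw [hD]
    ring
  refine antitoneOn_of_hasDerivWithinAt_nonpos (convex_Ici 2)
    (fun x hx => (hd x hx).continuousAt.continuousWithinAt)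
    (fun x hx => (hd x (interior_subset hx)).hasDerivWithinAt) (fun x _ => ?_)
  rw [neg_nonpos]; positivity


/-! ### Power series bounds for `J₀` and `J₁` -/

theorem integral_cos_pow_zero_pi (n : ℕ) : ∫ θ in (0 : ℝ)..Real.pi, Real.cos θ ^ (n + 2) =
    (n + 1) / (n + 2) * ∫ θ in (0 : ℝ)..Real.pi, Real.cos θ ^ n := by
  rw [integral_cos_pow]; simp

theorem nonneg_of_hasDerivAt {f f' : ℝ → ℝ} (hd : ∀ y, HasDerivAt f (f' y) y) (h0 : f 0 = 0)
    (hf : ∀ y, 0 ≤ y → 0 ≤ f' y) {y : ℝ} (hy : 0 ≤ y) : 0 ≤ f y := by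
  have hm : MonotoneOn f (Ici 0) := monotoneOn_of_hasDerivWithinAt_nonneg (convex_Ici 0)
    (fun x _ => (hd x).continuousAt.continuousWithinAt) (fun x _ => (hd x).hasDerivWithinAt)
    (fun x hx => hf x (interior_subset hx))
  exact h0 ▸ hm (mem_Ici.2 le_rfl) (mem_Ici.2 hy) hy

/-- Each bound is the integral from 0 of the preceding one, alternating between sine and cosine and
starting from `1 - z²/2 ≤ cos z`. -/
theorem cos_taylor_bounds_of_nonneg {y : ℝ} (hy : 0 ≤ y) :
    Real.cos y ≤ 1 - y ^ 2 / 2 + y ^ 4 / 24 ∧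
    1 - y ^ 2 / 2 + y ^ 4 / 24 - y ^ 6 / 720 ≤ Real.cos y ∧
    Real.cos y ≤ 1 - y ^ 2 / 2 + y ^ 4 / 24 - y ^ 6 / 720 + y ^ 8 / 40320 := by
  have hp : ∀ (n : ℕ) (c y : ℝ), HasDerivAt (fun y => y ^ n / c) (n * y ^ (n - 1) / c) y :=
    fun n c y => (hasDerivAt_pow n y).div_const c
  have s3 : ∀ z : ℝ, 0 ≤ z → 0 ≤ Real.sin z - z + z ^ 3 / 6 := fun z hz =>
    nonneg_of_hasDerivAt (y := z) (f' := fun z => Real.cos z - 1 + (3 : ℕ) * z ^ 2 / 6)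
      (fun z => ((Real.hasDerivAt_sin z).sub (hasDerivAt_id z)).add (hp 3 6 z)) (by simp)
      (fun z _ => by have := Real.one_sub_sq_div_two_le_cos (x := z); push_cast; linarith) hz
  have c4 : ∀ z : ℝ, 0 ≤ z → 0 ≤ 1 - z ^ 2 / 2 + z ^ 4 / 24 - Real.cos z := fun z hz =>
    nonneg_of_hasDerivAt (y := z)
      (f' := fun z => 0 - (2 : ℕ) * z ^ 1 / 2 + (4 : ℕ) * z ^ 3 / 24 - -Real.sin z)
      (fun z => ((((hasDerivAt_const z 1).sub (hp 2 2 z)).add (hp 4 24 z)).sub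
        (Real.hasDerivAt_cos z))) (by simp)
      (fun z hz => by have := s3 z hz; push_cast; linarith) hz
  have s5 : ∀ z : ℝ, 0 ≤ z → 0 ≤ z - z ^ 3 / 6 + z ^ 5 / 120 - Real.sin z := fun z hz =>
    nonneg_of_hasDerivAt (y := z)
      (f' := fun z => 1 - (3 : ℕ) * z ^ 2 / 6 + (5 : ℕ) * z ^ 4 / 120 - Real.cos z)
      (fun z => ((((hasDerivAt_id z).sub (hp 3 6 z)).add (hp 5 120 z)).sub
        (Real.hasDerivAt_sin z))) (by simp)
      (fun z hz => by have := c4 z hz; push_cast; linarith) hz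
  have c6 : ∀ z : ℝ, 0 ≤ z → 0 ≤ Real.cos z - 1 + z ^ 2 / 2 - z ^ 4 / 24 + z ^ 6 / 720 :=
    fun z hz => nonneg_of_hasDerivAt (y := z)
      (f' := fun z => -Real.sin z - 0 + (2 : ℕ) * z ^ 1 / 2 - (4 : ℕ) * z ^ 3 / 24 +
        (6 : ℕ) * z ^ 5 / 720)
      (fun z => (((((Real.hasDerivAt_cos z).sub (hasDerivAt_const z 1)).add (hp 2 2 z)).sub
        (hp 4 24 z)).add (hp 6 720 z))) (by simp)
      (fun z hz => by have := s5 z hz; push_cast; linarith) hz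
  have s7 : ∀ z : ℝ, 0 ≤ z → 0 ≤ Real.sin z - z + z ^ 3 / 6 - z ^ 5 / 120 + z ^ 7 / 5040 :=
    fun z hz => nonneg_of_hasDerivAt (y := z)
      (f' := fun z => Real.cos z - 1 + (3 : ℕ) * z ^ 2 / 6 - (5 : ℕ) * z ^ 4 / 120 +
        (7 : ℕ) * z ^ 6 / 5040)
      (fun z => (((((Real.hasDerivAt_sin z).sub (hasDerivAt_id z)).add (hp 3 6 z)).sub
        (hp 5 120 z)).add (hp 7 5040 z))) (by simp)
      (fun z hz => by have := c6 z hz; push_cast; linarith) hz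
  have c8 : ∀ z : ℝ, 0 ≤ z →
      0 ≤ 1 - z ^ 2 / 2 + z ^ 4 / 24 - z ^ 6 / 720 + z ^ 8 / 40320 - Real.cos z :=
    fun z hz => nonneg_of_hasDerivAt (y := z)
      (f' := fun z => 0 - (2 : ℕ) * z ^ 1 / 2 + (4 : ℕ) * z ^ 3 / 24 - (6 : ℕ) * z ^ 5 / 720 +
        (8 : ℕ) * z ^ 7 / 40320 - -Real.sin z)
      (fun z => ((((((hasDerivAt_const z 1).sub (hp 2 2 z)).add (hp 4 24 z)).sub
        (hp 6 720 z)).add (hp 8 40320 z)).sub (Real.hasDerivAt_cos z))) (by simp)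
      (fun z hz => by have := s7 z hz; push_cast; linarith) hz
  exact ⟨by linarith [c4 y hy], by linarith [c6 y hy], by linarith [c8 y hy]⟩

theorem cos_taylor_bounds (y : ℝ) :
    Real.cos y ≤ 1 - y ^ 2 / 2 + y ^ 4 / 24 ∧
    1 - y ^ 2 / 2 + y ^ 4 / 24 - y ^ 6 / 720 ≤ Real.cos y ∧
    Real.cos y ≤ 1 - y ^ 2 / 2 + y ^ 4 / 24 - y ^ 6 / 720 + y ^ 8 / 40320 := by
  have h := cos_taylor_bounds_of_nonneg (abs_nonneg y)
  have h2 : |y| ^ 2 = y ^ 2 := sq_abs y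
  have h4 : |y| ^ 4 = y ^ 4 := by rw [show 4 = 2 * 2 from rfl, pow_mul, h2, ← pow_mul]
  have h6 : |y| ^ 6 = y ^ 6 := by rw [show 6 = 2 * 3 from rfl, pow_mul, h2, ← pow_mul]
  have h8 : |y| ^ 8 = y ^ 8 := by rw [show 8 = 2 * 4 from rfl, pow_mul, h2, ← pow_mul]
  rwa [Real.cos_abs, h2, h4, h6, h8] at h

/-- The rational factors are the Wallis means of `cos^(2j) θ` over `[0, π]`. -/
theorem integral_even_poly_cos (c₀ c₁ c₂ c₃ c₄ c₅ : ℝ) :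
    ∫ θ in (0 : ℝ)..Real.pi, (c₀ + c₁ * Real.cos θ ^ 2 + c₂ * Real.cos θ ^ 4 +
      c₃ * Real.cos θ ^ 6 + c₄ * Real.cos θ ^ 8 + c₅ * Real.cos θ ^ 10) =
    Real.pi * (c₀ + c₁ * (1 / 2) + c₂ * (3 / 8) + c₃ * (5 / 16) + c₄ * (35 / 128) +
      c₅ * (63 / 256)) := by
  have hI : ∀ (c : ℝ) (n : ℕ), IntervalIntegrable (fun θ => c * Real.cos θ ^ n) volume 0 Real.pi :=
    fun c n => Continuous.intervalIntegrable (by fun_prop) _ _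
  have h0 : ∫ θ in (0 : ℝ)..Real.pi, Real.cos θ ^ 0 = Real.pi := by simp
  have h2 := integral_cos_pow_zero_pi 0
  have h4 := integral_cos_pow_zero_pi 2
  have h6 := integral_cos_pow_zero_pi 4
  have h8 := integral_cos_pow_zero_pi 6
  have h10 := integral_cos_pow_zero_pi 8
  simp only [zero_add, Nat.reduceAdd] at h2 h4 h6 h8 h10
  rw [h0] at h2; rw [h2] at h4; rw [h4] at h6; rw [h6] at h8; rw [h8] at h10
  rw [intervalIntegral.integral_add ((((intervalIntegrable_const.add (hI _ _)).add (hI _ _)).add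
      (hI _ _)).add (hI _ _)) (hI _ _),
    intervalIntegral.integral_add (((intervalIntegrable_const.add (hI _ _)).add (hI _ _)).add
      (hI _ _)) (hI _ _),
    intervalIntegral.integral_add ((intervalIntegrable_const.add (hI _ _)).add (hI _ _)) (hI _ _),
    intervalIntegral.integral_add (intervalIntegrable_const.add (hI _ _)) (hI _ _),
    intervalIntegral.integral_add intervalIntegrable_const (hI _ _)]
  simp only [intervalIntegral.integral_const_mul, intervalIntegral.integral_const, smul_eq_mul]
  rw [h2, h4, h6, h8, h10]
  push_cast; ring

theorem integral_le_of_even_poly_cos {f : ℝ → ℝ} (hf : Continuous f) (c₀ c₁ c₂ c₃ c₄ c₅ : ℝ)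
    (h : ∀ θ, f θ ≤ c₀ + c₁ * Real.cos θ ^ 2 + c₂ * Real.cos θ ^ 4 +
      c₃ * Real.cos θ ^ 6 + c₄ * Real.cos θ ^ 8 + c₅ * Real.cos θ ^ 10) :
    Real.pi⁻¹ * ∫ θ in (0 : ℝ)..Real.pi, f θ ≤ c₀ + c₁ * (1 / 2) + c₂ * (3 / 8) + c₃ * (5 / 16) +
      c₄ * (35 / 128) + c₅ * (63 / 256) := by
  rw [inv_mul_le_iff₀ Real.pi_pos, ← integral_even_poly_cos]
  exact intervalIntegral.integral_mono Real.pi_pos.le (hf.intervalIntegrable _ _)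
    (Continuous.intervalIntegrable (by fun_prop) _ _) h

theorem le_integral_of_even_poly_cos {f : ℝ → ℝ} (hf : Continuous f) (c₀ c₁ c₂ c₃ c₄ c₅ : ℝ)
    (h : ∀ θ, c₀ + c₁ * Real.cos θ ^ 2 + c₂ * Real.cos θ ^ 4 +
      c₃ * Real.cos θ ^ 6 + c₄ * Real.cos θ ^ 8 + c₅ * Real.cos θ ^ 10 ≤ f θ) :
    c₀ + c₁ * (1 / 2) + c₂ * (3 / 8) + c₃ * (5 / 16) + c₄ * (35 / 128) + c₅ * (63 / 256) ≤
      Real.pi⁻¹ * ∫ θ in (0 : ℝ)..Real.pi, f θ := by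
  rw [le_inv_mul_iff₀ Real.pi_pos, ← integral_even_poly_cos]
  exact intervalIntegral.integral_mono Real.pi_pos.le
    (Continuous.intervalIntegrable (by fun_prop) _ _) (hf.intervalIntegrable _ _) h

/-- Averaging the Taylor bounds of the cosine with weight `sin² θ` reproduces the partial sums of
the power series of `J₁`. -/
theorem besselJ1_le {x : ℝ} (hx : 0 ≤ x) : besselJ1 x ≤ x / 2 - x ^ 3 / 16 + x ^ 5 / 384 := by
  rw [besselJ1_eq]
  refine (mul_le_mul_of_nonneg_left (integral_le_of_even_poly_cos (by fun_prop)
    1 (-1 - x ^ 2 / 2) (x ^ 2 / 2 + x ^ 4 / 24) (-x ^ 4 / 24) 0 0 fun θ => ?_) hx).trans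
    (le_of_eq (by ring))
  refine (mul_le_mul_of_nonneg_left (cos_taylor_bounds _).1 (sq_nonneg _)).trans (le_of_eq ?_)
  rw [Real.sin_sq]; ring

theorem le_besselJ1 {x : ℝ} (hx : 0 ≤ x) :
    x / 2 - x ^ 3 / 16 + x ^ 5 / 384 - x ^ 7 / 18432 ≤ besselJ1 x := by
  rw [besselJ1_eq]
  refine (le_of_eq (by ring)).trans (mul_le_mul_of_nonneg_left (le_integral_of_even_poly_cos
    (by fun_prop) 1 (-1 - x ^ 2 / 2) (x ^ 2 / 2 + x ^ 4 / 24) (-x ^ 4 / 24 - x ^ 6 / 720)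
    (x ^ 6 / 720) 0 fun θ => ?_) hx)
  refine (le_of_eq ?_).trans (mul_le_mul_of_nonneg_left (cos_taylor_bounds _).2.1 (sq_nonneg _))
  rw [Real.sin_sq]; ring

theorem besselJ0_le (x : ℝ) :
    besselJ0 x ≤ 1 - x ^ 2 / 4 + x ^ 4 / 64 - x ^ 6 / 2304 + x ^ 8 / 147456 := by
  refine (integral_le_of_even_poly_cos (by fun_prop) 1 (-x ^ 2 / 2) (x ^ 4 / 24) (-x ^ 6 / 720)
    (x ^ 8 / 40320) 0 fun θ => ?_).trans (le_of_eq (by ring))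
  exact (cos_taylor_bounds _).2.2.trans (le_of_eq (by ring))

theorem le_besselJ0 (x : ℝ) : 1 - x ^ 2 / 4 + x ^ 4 / 64 - x ^ 6 / 2304 ≤ besselJ0 x := by
  refine (le_of_eq (by ring)).trans (le_integral_of_even_poly_cos (by fun_prop) 1 (-x ^ 2 / 2)
    (x ^ 4 / 24) (-x ^ 6 / 720) 0 0 fun θ => ?_)
  exact (le_of_eq (by ring)).trans (cos_taylor_bounds _).2.1

/-- `√x |J₁(x)| ≤ √(2π) / 3`. -/
theorem mul_besselJ1_sq_le {x : ℝ} (hx : 0 < x) : x * besselJ1 x ^ 2 ≤ 2 * Real.pi / 9 := by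
  have hpi := Real.pi_gt_d4
  -- The cut at 2 lies just past the first maximum of `J₁`. Both sides have little room: `2 · 0.59²
  -- = 0.6962` and `sonine 2 ≤ 0.697`, against `2π/9 = 0.6981...`.
  rcases le_total x 2 with h2 | h2
  · have hu := besselJ1_le hx.le
    have hl : 0 ≤ besselJ1 x := by
      refine le_trans ?_ (le_besselJ1 hx.le)
      have : 0 ≤ x * (1 / 4 + (4 - x ^ 2) / 16 + x ^ 4 * (4 - x ^ 2) / 18432) := by
        have : 0 ≤ 4 - x ^ 2 := by nlinarith
        positivity
      nlinarith [pow_pos hx 5]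
    have hw : x / 2 - x ^ 3 / 16 + x ^ 5 / 384 ≤ 0.59 := by
      -- The quintic peaks near `x = 1.88`. The cubic is the approximate quotient of `384 (0.59 -
      -- quintic)` by `(x - 1.88)²`; the remainder is positive on `[0, 2]`.
      have hq : 0 ≤ -x ^ 3 - 3.76 * x ^ 2 + 13.39 * x + 63 := by
        nlinarith [mul_nonneg hx.le (sub_nonneg.2 h2), mul_nonneg (mul_nonneg hx.le hx.le)
          (sub_nonneg.2 h2)]
      nlinarith [mul_nonneg (sq_nonneg (x - 1.88)) hq]
    have h3 : besselJ1 x ^ 2 ≤ 0.59 ^ 2 := pow_le_pow_left₀ hl (hu.trans hw) 2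
    nlinarith
  · have hS := antitoneOn_sonine (mem_Ici.2 le_rfl) (mem_Ici.2 h2) h2
    have h1 : x * besselJ1 x ^ 2 ≤ sonine x := by
      have : 0 < 4 * x ^ 2 - 3 := by nlinarith
      have : 0 ≤ (x * besselJ0 x - besselJ1 x / 2) ^ 2 * (4 * x / (4 * x ^ 2 - 3)) := by
        positivity
      unfold sonine; linarith
    have h3 : sonine 2 ≤ 0.697 := by
      have a1 := besselJ1_le (x := 2) (by norm_num)
      have a2 := le_besselJ1 (x := 2) (by norm_num)
      have a3 := besselJ0_le 2
      have a4 := le_besselJ0 2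
      norm_num at a1 a2 a3 a4
      -- Here `7/12` is the value at 2 of the quintic bound for `J₁`.
      have b1 : besselJ1 2 ^ 2 ≤ (7 / 12) ^ 2 := pow_le_pow_left₀ (by linarith) (by linarith) 2
      have b2 : (2 * besselJ0 2 - besselJ1 2 / 2) ^ 2 ≤ 0.16 ^ 2 :=
        pow_le_pow_left₀ (by linarith) (by linarith) 2
      norm_num [sonine]
      norm_num at b1 b2
      linarith
    linarith

/-! ### The Fourier transform of an elliptic disc -/

/-- By Fubini: the slice of the disc over `s` has length `2 √(1 - s²)`. -/
theorem setIntegral_unitDisc (f : ℝ → ℂ) (hf : Continuous f) :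
    ∫ y in unitDisc, f (y 0) = ∫ s in (-1 : ℝ)..1, (2 * √(1 - s ^ 2)) • f s := by
  have hD : MeasurableSet unitDisc := (isClosed_le (by fun_prop) continuous_const).measurableSet
  have hD' : MeasurableSet {p : ℝ × ℝ | p.1 ^ 2 + p.2 ^ 2 ≤ 1} :=
    (isClosed_le (by fun_prop) continuous_const).measurableSet
  have h1 : ∫ y in unitDisc, f (y 0) = ∫ p : ℝ × ℝ in {p | p.1 ^ 2 + p.2 ^ 2 ≤ 1}, f p.1 :=
    (volume_preserving_finTwoArrow ℝ).setIntegral_preimage_emb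
      MeasurableEquiv.finTwoArrow.measurableEmbedding (fun p => f p.1)
      {p | p.1 ^ 2 + p.2 ^ 2 ≤ 1}
  have hsub : {p : ℝ × ℝ | p.1 ^ 2 + p.2 ^ 2 ≤ 1} ⊆ Icc (-1) 1 ×ˢ Icc (-1) 1 := by
    rintro ⟨a, b⟩ h
    simp only [mem_ofPred_eq] at h
    exact ⟨⟨by nlinarith, by nlinarith⟩, ⟨by nlinarith, by nlinarith⟩⟩
  have hint : Integrable ({p : ℝ × ℝ | p.1 ^ 2 + p.2 ^ 2 ≤ 1}.indicator fun p => f p.1) := by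
    rw [integrable_indicator_iff hD']
    exact (Continuous.continuousOn (by fun_prop)).integrableOn_compact
      (isCompact_Icc.prod isCompact_Icc) |>.mono_set hsub
  rw [h1, ← integral_indicator hD', Measure.volume_eq_prod, integral_prod _ hint,
    intervalIntegral.integral_of_le (by norm_num), ← integral_Icc_eq_integral_Ioc,
    ← integral_indicator measurableSet_Icc]
  congr 1; ext x
  by_cases hx : x ∈ Icc (-1 : ℝ) 1
  · have hx1 : 0 ≤ 1 - x ^ 2 := by nlinarith [hx.1, hx.2]
    rw [indicator_of_mem hx]
    have : (fun y => {p : ℝ × ℝ | p.1 ^ 2 + p.2 ^ 2 ≤ 1}.indicator (fun p => f p.1) (x, y)) =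
        (Icc (-√(1 - x ^ 2)) (√(1 - x ^ 2))).indicator fun _ => f x := by
      ext y
      have : (x, y) ∈ {p : ℝ × ℝ | p.1 ^ 2 + p.2 ^ 2 ≤ 1} ↔
          y ∈ Icc (-√(1 - x ^ 2)) (√(1 - x ^ 2)) := by
        rw [mem_Icc, ← abs_le, ← Real.sqrt_sq_eq_abs, Real.sqrt_le_sqrt_iff hx1, mem_ofPred_eq]
        constructor <;> intro h <;> linarith
      by_cases hy : y ∈ Icc (-√(1 - x ^ 2)) (√(1 - x ^ 2))
      · rw [indicator_of_mem hy, indicator_of_mem (this.2 hy)]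
      · rw [indicator_of_notMem hy, indicator_of_notMem (fun h => hy (this.1 h))]
    rw [this, integral_indicator measurableSet_Icc, setIntegral_const, Real.volume_real_Icc_of_le
      (by linarith [Real.sqrt_nonneg (1 - x ^ 2)])]
    congr 1; ring
  · rw [indicator_of_notMem hx]
    refine integral_eq_zero_of_ae (Eventually.of_forall fun y => ?_)
    refine indicator_of_notMem (fun h => hx (hsub h).1) _

theorem integral_sqrt_mul_exp {x : ℝ} (hx : x ≠ 0) :
    ∫ s in (-1 : ℝ)..1, (2 * √(1 - s ^ 2)) • Complex.exp (-((x * s : ℝ) : ℂ) * Complex.I) =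
      ((2 * Real.pi * besselJ1 x / x : ℝ) : ℂ) := by
  have h := intervalIntegral.integral_deriv_smul_comp (a := Real.pi) (b := 0)
    (f := Real.cos) (f' := fun θ => -Real.sin θ)
    (g := fun s => (2 * √(1 - s ^ 2)) • Complex.exp (-((x * s : ℝ) : ℂ) * Complex.I))
    (fun θ _ => Real.hasDerivAt_cos θ) (by fun_prop) (by fun_prop)
  rw [Real.cos_pi, Real.cos_zero] at h
  rw [← h, intervalIntegral.integral_symm, ← intervalIntegral.integral_neg]
  have h2 : ∫ θ in (0 : ℝ)..Real.pi, -(-Real.sin θ •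
      ((fun s => (2 * √(1 - s ^ 2)) • Complex.exp (-((x * s : ℝ) : ℂ) * Complex.I)) ∘ Real.cos) θ) =
      ∫ θ in (0 : ℝ)..Real.pi, (((2 * Real.sin θ ^ 2 * Real.cos (x * Real.cos θ) : ℝ) : ℂ) -
        ((2 * Real.sin θ ^ 2 * Real.sin (x * Real.cos θ) : ℝ) : ℂ) * Complex.I) := by
    refine intervalIntegral.integral_congr fun θ hθ => ?_
    rw [uIcc_of_le Real.pi_pos.le] at hθ
    have : √(1 - Real.cos θ ^ 2) = Real.sin θ := by
      rw [← Real.sin_sq, Real.sqrt_sq (Real.sin_nonneg_of_mem_Icc hθ)]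
    simp only [Function.comp, this, Complex.real_smul]
    rw [← Complex.ofReal_neg, Complex.exp_mul_I, ← Complex.ofReal_cos,
      ← Complex.ofReal_sin, Real.cos_neg, Real.sin_neg]
    push_cast; ring
  -- After `s = cos θ` the imaginary part is odd under `θ ↦ π - θ`.
  have h3 : ∫ θ in (0 : ℝ)..Real.pi, 2 * Real.sin θ ^ 2 * Real.sin (x * Real.cos θ) = 0 := by
    have := intervalIntegral.integral_comp_sub_left (a := 0) (b := Real.pi)
      (fun θ => 2 * Real.sin θ ^ 2 * Real.sin (x * Real.cos θ)) Real.pi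
    simp only [Real.sin_pi_sub, Real.cos_pi_sub, mul_neg, Real.sin_neg, sub_self, sub_zero,
      intervalIntegral.integral_neg] at this
    linarith
  rw [h2, intervalIntegral.integral_sub (Continuous.intervalIntegrable (by fun_prop) _ _)
    (Continuous.intervalIntegrable (by fun_prop) _ _), intervalIntegral.integral_mul_const,
    intervalIntegral.integral_ofReal, intervalIntegral.integral_ofReal, h3, besselJ1_eq]
  simp_rw [mul_assoc (2 : ℝ)]
  rw [intervalIntegral.integral_const_mul]
  simp only [Complex.ofReal_zero, zero_mul, sub_zero]
  congr 1
  have := Real.pi_ne_zero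
  field_simp

/-! ### Reduction of the elliptic disc to the unit disc -/

variable {A : Matrix (Fin 2) (Fin 2) ℝ}

theorem quadForm_apply (A : Matrix (Fin 2) (Fin 2) ℝ) (x : Fin 2 → ℝ) : quadForm A x =
    A 0 0 * x 0 ^ 2 + (A 0 1 + A 1 0) * x 0 * x 1 + A 1 1 * x 1 ^ 2 := by
  simp [quadForm, Matrix.mulVec, dotProduct, Fin.sum_univ_two]; ring

theorem isSymm_entry (hA : A.PosDef) : A 1 0 = A 0 1 := by
  simpa using hA.isHermitian.apply 0 1

theorem quadForm_inv_apply (hA : A.PosDef) (hdet : A.det = 1) (x : Fin 2 → ℝ) : quadForm A⁻¹ x =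
    A 1 1 * x 0 ^ 2 - 2 * A 0 1 * x 0 * x 1 + A 0 0 * x 1 ^ 2 := by
  rw [quadForm_apply, Matrix.inv_def, hdet, Matrix.adjugate_fin_two]
  simp [isSymm_entry hA]; ring

theorem continuous_quadForm (A : Matrix (Fin 2) (Fin 2) ℝ) : Continuous (quadForm A) := by
  simp_rw [funext (quadForm_apply A)]; fun_prop

/-- Unimodular coordinates that turn `Q` into a sum of two squares and the linear form `k` into
`g(k)` times the first coordinate. -/
theorem exists_frame (hA : A.PosDef) (hdet : A.det = 1) (k : Fin 2 → ℝ) :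
    ∃ N : Matrix (Fin 2) (Fin 2) ℝ, N.det = 1 ∧
      (∀ x, quadForm A x = (N *ᵥ x) 0 ^ 2 + (N *ᵥ x) 1 ^ 2) ∧
      ∀ x, k ⬝ᵥ x = supportFn A k * (N *ᵥ x) 0 := by
  have ha : 0 < A 0 0 := hA.diag_pos
  have hs : 0 < √(A 0 0) := Real.sqrt_pos.2 ha
  have hsq : √(A 0 0) ^ 2 = A 0 0 := Real.sq_sqrt ha.le
  have hsym := isSymm_entry hA
  have hd : A 0 0 * A 1 1 - A 0 1 ^ 2 = 1 := by
    rw [← hdet, Matrix.det_fin_two, hsym]; ring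
  obtain ⟨s, hs'⟩ : ∃ s, s = √(A 0 0) := ⟨_, rfl⟩
  rw [← hs'] at hs hsq
  have hd' : A 1 1 = (1 + A 0 1 ^ 2) / s ^ 2 := by
    rw [eq_div_iff (by positivity), hsq]; linarith
  obtain ⟨b, hb⟩ : ∃ b, b = A 0 1 := ⟨_, rfl⟩
  -- Completing the square gives the Cholesky factor of `A`, of determinant 1. In its coordinates
  -- `k` becomes `(p, q)`, of Euclidean length `g(k)`.
  have hM : ∀ x : Fin 2 → ℝ, quadForm A x = (s * x 0 + b / s * x 1) ^ 2 + (x 1 / s) ^ 2 := by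
    intro x
    rw [quadForm_apply, hsym, hd', ← hsq, ← hb]
    field_simp
    ring
  have hg0 : 0 ≤ supportFn A k := Real.sqrt_nonneg _
  have hg : supportFn A k ^ 2 = (k 0 / s) ^ 2 + (s * k 1 - b / s * k 0) ^ 2 := by
    have : quadForm A⁻¹ k = (k 0 / s) ^ 2 + (s * k 1 - b / s * k 0) ^ 2 := by
      rw [quadForm_inv_apply hA hdet, hd', ← hsq, ← hb]
      field_simp
      ring
    rw [supportFn, Real.sq_sqrt (by rw [this]; positivity), this]
  obtain ⟨g, hgg⟩ : ∃ g, g = supportFn A k := ⟨_, rfl⟩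
  rw [← hgg] at hg hg0 ⊢
  obtain ⟨p, hp⟩ : ∃ p, p = k 0 / s := ⟨_, rfl⟩
  obtain ⟨q, hq⟩ : ∃ q, q = s * k 1 - b / s * k 0 := ⟨_, rfl⟩
  rw [← hp, ← hq] at hg
  have hk : ∀ x : Fin 2 → ℝ, k ⬝ᵥ x = p * (s * x 0 + b / s * x 1) + q * (x 1 / s) := by
    intro x
    rw [hp, hq]
    simp only [dotProduct, Fin.sum_univ_two]
    field_simp
    ring
  rcases hg0.eq_or_lt with h0 | h0
  · have hp0 : p = 0 := by nlinarith [sq_nonneg p, sq_nonneg q]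
    have hq0 : q = 0 := by nlinarith [sq_nonneg p, sq_nonneg q]
    refine ⟨!![s, b / s; 0, 1 / s], ?_, fun x => ?_, fun x => ?_⟩
    · rw [Matrix.det_fin_two_of]; field_simp; ring
    · rw [hM]; simp [Matrix.mulVec, dotProduct, Fin.sum_univ_two]; ring
    · rw [hk, hp0, hq0, ← h0]; ring
  -- The rotation that carries `(p, q)` to the first axis; it preserves the sum of squares.
  · refine ⟨!![p / g, q / g; -q / g, p / g] * !![s, b / s; 0, 1 / s], ?_, fun x => ?_, fun x => ?_⟩
    · rw [Matrix.det_mul, Matrix.det_fin_two_of, Matrix.det_fin_two_of]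
      field_simp
      linear_combination (-s) * hg
    · rw [hM, ← Matrix.mulVec_mulVec]
      simp only [Matrix.mulVec, dotProduct, Fin.sum_univ_two, Matrix.of_apply, Matrix.cons_val',
        Matrix.cons_val_zero, Matrix.cons_val_one, Matrix.cons_val_fin_one, zero_mul, zero_add]
      obtain ⟨u, hu⟩ : ∃ u, u = s * x 0 + b / s * x 1 := ⟨_, rfl⟩
      rw [← hu]
      field_simp
      linear_combination (u ^ 2 * s ^ 2 + x 1 ^ 2) * hg
    · rw [hk, ← Matrix.mulVec_mulVec]
      simp only [Matrix.mulVec, dotProduct, Fin.sum_univ_two, Matrix.of_apply, Matrix.cons_val',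
        Matrix.cons_val_zero, Matrix.cons_val_one, Matrix.cons_val_fin_one, zero_mul, zero_add]
      field_simp

/-- The dilated elliptic disc `Q ≤ r²`. -/
def scaledEllipse (A : Matrix (Fin 2) (Fin 2) ℝ) (r : ℝ) : Set (Fin 2 → ℝ) :=
  {x | quadForm A x ≤ r ^ 2}

theorem isClosed_scaledEllipse (A : Matrix (Fin 2) (Fin 2) ℝ) (r : ℝ) :
    IsClosed (scaledEllipse A r) :=
  isClosed_le (continuous_quadForm A) continuous_const

/-- The map `r⁻¹ N`, with `N` from `exists_frame`, carries the ellipse onto the unit disc and scales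
area by `r⁻²`; the integrand then depends on the first coordinate only. -/
theorem setIntegral_scaledEllipse (hA : A.PosDef) (hdet : A.det = 1) {r : ℝ} (hr : 0 < r)
    (k : Fin 2 → ℝ) {f : ℝ → ℂ} (hf : Continuous f) :
    ∫ x in scaledEllipse A r, f (k ⬝ᵥ x) =
      (r ^ 2 : ℝ) • ∫ s in (-1 : ℝ)..1, (2 * √(1 - s ^ 2)) • f (r * supportFn A k * s) := by
  obtain ⟨N, hN, hQ, hk⟩ := exists_frame hA hdet k
  have hP : (r⁻¹ • N).det = r⁻¹ ^ 2 := by simp [hN]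
  have hD : MeasurableSet unitDisc := (isClosed_le (by fun_prop) continuous_const).measurableSet
  have hcont : Continuous (Matrix.toLin' (r⁻¹ • N)) := LinearMap.continuous_on_pi _
  have hmap := Real.map_matrix_volume_pi_eq_smul_volume_pi (M := r⁻¹ • N)
    (by rw [hP]; positivity)
  rw [← setIntegral_unitDisc (fun s => f (r * supportFn A k * s)) (by fun_prop),
    ← integral_indicator hD, ← integral_indicator (isClosed_scaledEllipse A r).measurableSet]
  have h1 : (scaledEllipse A r).indicator (fun x => f (k ⬝ᵥ x)) = fun x =>
      (unitDisc.indicator fun y => f (r * supportFn A k * y 0)) (Matrix.toLin' (r⁻¹ • N) x) := by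
    ext x
    have hx : x ∈ scaledEllipse A r ↔ Matrix.toLin' (r⁻¹ • N) x ∈ unitDisc := by
      simp only [scaledEllipse, unitDisc, mem_ofPred_eq, hQ, Matrix.toLin'_apply,
        Matrix.smul_mulVec, Pi.smul_apply, smul_eq_mul]
      rw [mul_pow, mul_pow, ← mul_add, inv_pow, inv_mul_le_iff₀ (by positivity), mul_one]
    by_cases h : x ∈ scaledEllipse A r
    · rw [indicator_of_mem h, indicator_of_mem (hx.1 h), hk]
      simp only [Matrix.toLin'_apply, Matrix.smul_mulVec, Pi.smul_apply, smul_eq_mul]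
      congr 1
      field_simp
    · rw [indicator_of_notMem h, indicator_of_notMem (fun h' => h (hx.2 h'))]
  rw [h1, ← integral_map hcont.measurable.aemeasurable, hmap, integral_smul_measure, hP]
  · congr 1
    rw [ENNReal.toReal_ofReal (abs_nonneg _), abs_of_pos (by positivity)]
    simp
  · exact (StronglyMeasurable.indicator (Continuous.stronglyMeasurable (by fun_prop))
      hD).aestronglyMeasurable

theorem volume_real_scaledEllipse (hA : A.PosDef) (hdet : A.det = 1) {r : ℝ} (hr : 0 < r) :
    volume.real (scaledEllipse A r) = Real.pi * r ^ 2 := by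
  have h := setIntegral_scaledEllipse hA hdet hr 0 (f := fun _ => 1) continuous_const
  have h2 : ∫ s in (-1 : ℝ)..1, (2 * √(1 - s ^ 2)) • (1 : ℂ) = (Real.pi : ℂ) := by
    simp only [Complex.real_smul, mul_one]
    rw [intervalIntegral.integral_ofReal, intervalIntegral.integral_const_mul,
      integral_sqrt_one_sub_sq]
    congr 1; ring
  rw [setIntegral_const, h2, Complex.real_smul, Complex.real_smul, mul_one] at h
  rw [mul_comm]
  exact_mod_cast h

/-- The Fourier transform of the indicator function of a set. -/
def indicatorFourier (S : Set (Fin 2 → ℝ)) (k : Fin 2 → ℝ) : ℂ :=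
  ∫ x in S, Complex.exp (-((2 * Real.pi * (k ⬝ᵥ x) : ℝ) : ℂ) * Complex.I)

theorem norm_indicatorFourier_le (S : Set (Fin 2 → ℝ)) (k : Fin 2 → ℝ) :
    ‖indicatorFourier S k‖ ≤ volume.real S := by
  refine (norm_integral_le_integral_norm _).trans (le_of_eq ?_)
  simp_rw [← Complex.ofReal_neg, Complex.norm_exp_ofReal_mul_I]
  simp

theorem indicatorFourier_zero (S : Set (Fin 2 → ℝ)) :
    indicatorFourier S 0 = (volume.real S : ℂ) := by
  simp [indicatorFourier]

/-- The transform equals `(r/g) J₁(2πrg)`, and `mul_besselJ1_sq_le` at `x = 2πrg` bounds its square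
by `r/(9g³)`. -/
theorem norm_indicatorFourier_scaledEllipse_le (hA : A.PosDef) (hdet : A.det = 1) {r : ℝ}
    (hr : 0 < r) {k : Fin 2 → ℝ} (hk : 0 < supportFn A k) :
    ‖indicatorFourier (scaledEllipse A r) k‖ ≤
      r ^ (1 / 2 : ℝ) * supportFn A k ^ (-(3 / 2) : ℝ) / 3 := by
  obtain ⟨g, hg⟩ : ∃ g, g = supportFn A k := ⟨_, rfl⟩
  have hpi := Real.pi_pos
  rw [← hg] at hk ⊢
  have hx : 0 < 2 * Real.pi * (r * g) := by positivity
  have h1 : indicatorFourier (scaledEllipse A r) k =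
      ((r / g * besselJ1 (2 * Real.pi * (r * g)) : ℝ) : ℂ) := by
    rw [indicatorFourier, setIntegral_scaledEllipse hA hdet hr k
      (f := fun u => Complex.exp (-((2 * Real.pi * u : ℝ) : ℂ) * Complex.I)) (by fun_prop), ← hg]
    simp_rw [← mul_assoc (2 * Real.pi)]
    rw [← mul_assoc] at hx
    rw [integral_sqrt_mul_exp hx.ne', Complex.real_smul, ← Complex.ofReal_mul]
    congr 1
    field_simp
  have h2 := mul_besselJ1_sq_le hx
  rw [h1, Complex.norm_real, Real.norm_eq_abs]
  refine abs_le_of_sq_le_sq ?_ (by positivity)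
  have e1 : (r ^ (1 / 2 : ℝ)) ^ 2 = r := by
    rw [← Real.rpow_natCast, ← Real.rpow_mul hr.le]; norm_num
  have e2 : (g ^ (-(3 / 2) : ℝ)) ^ 2 = (g ^ 3)⁻¹ := by
    rw [← Real.rpow_natCast, ← Real.rpow_mul hk.le, ← Real.rpow_natCast, ← Real.rpow_neg hk.le]
    norm_num
  rw [div_pow _ (3 : ℝ), mul_pow _ (g ^ _), e1, e2, mul_pow (r / g), div_pow r]
  have h3 : r * g * besselJ1 (2 * Real.pi * (r * g)) ^ 2 ≤ 1 / 9 := by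
    rw [← mul_le_mul_iff_right₀ (by positivity : 0 < 2 * Real.pi)]
    linarith
  calc r ^ 2 / g ^ 2 * besselJ1 (2 * Real.pi * (r * g)) ^ 2 =
      r / g ^ 3 * (r * g * besselJ1 (2 * Real.pi * (r * g)) ^ 2) := by field_simp
    _ ≤ r / g ^ 3 * (1 / 9) := by gcongr
    _ = _ := by ring

/-! ### Poisson summation in the plane -/

theorem toReal_add (m n : Fin 2 → ℤ) : toReal (m + n) = toReal m + toReal n := by
  ext i; simp [toReal]

theorem toReal_zero : toReal 0 = 0 := by
  ext i; simp [toReal]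

theorem finite_norm_toReal_le (C : ℝ) : {m : Fin 2 → ℤ | ‖toReal m‖ ≤ C}.Finite := by
  refine (Set.finite_Icc (fun _ => -⌈C⌉ : Fin 2 → ℤ) (fun _ => ⌈C⌉)).subset fun m hm => ?_
  have h : ∀ i, |(m i : ℝ)| ≤ ⌈C⌉ := fun i =>
    ((norm_le_pi_norm (toReal m) i).trans hm).trans (Int.le_ceil C)
  have h' : ∀ i, |m i| ≤ ⌈C⌉ := fun i => by exact_mod_cast h i
  exact ⟨fun i => (abs_le.1 (h' i)).1, fun i => (abs_le.1 (h' i)).2⟩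

/-- The projection of the plane onto the torus. -/
def toTorus : C(Fin 2 → ℝ, UnitAddTorus (Fin 2)) where
  toFun x i := (x i : UnitAddCircle)
  continuous_toFun := continuous_pi fun i =>
    (AddCircle.continuous_mk' 1).comp (continuous_apply i)

theorem isQuotientMap_toTorus : IsQuotientMap toTorus :=
  (IsOpenQuotientMap.piMap (fun _ : Fin 2 =>
    QuotientAddGroup.isOpenQuotientMap_mk (N := AddSubgroup.zmultiples (1 : ℝ)))).isQuotientMap

theorem toTorus_add_toReal (x : Fin 2 → ℝ) (m : Fin 2 → ℤ) :
    toTorus (x + toReal m) = toTorus x := by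
  ext i
  change ((x i + (m i : ℝ) : ℝ) : UnitAddCircle) = (x i : UnitAddCircle)
  have h0 : ((m i : ℝ) : UnitAddCircle) = 0 := (AddCircle.coe_eq_zero_iff (1 : ℝ)).2 ⟨m i, by simp⟩
  rw [AddCircle.coe_add, h0, add_zero]

theorem exists_toReal_of_toTorus_eq {x y : Fin 2 → ℝ} (h : toTorus x = toTorus y) :
    ∃ m, y = x + toReal m := by
  have h1 : ∀ i, ∃ n : ℤ, y i = x i + n := by
    intro i
    have hi : (x i : UnitAddCircle) = (y i : UnitAddCircle) := congrFun h i
    have : ((y i - x i : ℝ) : UnitAddCircle) = 0 := by rw [AddCircle.coe_sub, hi, sub_self]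
    obtain ⟨n, hn⟩ := (AddCircle.coe_eq_zero_iff (1 : ℝ)).1 this
    exact ⟨n, by simp at hn; linarith⟩
  choose m hm using h1
  exact ⟨m, funext hm⟩

theorem mFourier_toTorus (n : Fin 2 → ℤ) (x : Fin 2 → ℝ) :
    UnitAddTorus.mFourier (-n) (toTorus x) =
      Complex.exp (-((2 * Real.pi * (toReal n ⬝ᵥ x) : ℝ) : ℂ) * Complex.I) := by
  change ∏ i, fourier ((-n) i) ((x i : ℝ) : UnitAddCircle) = _
  simp_rw [fourier_coe_apply]
  rw [← Complex.exp_sum]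
  congr 1
  simp [Fin.sum_univ_two, dotProduct, toReal]
  ring

/-- Local finiteness makes the periodization of `h` a continuous function and later reduces its sums
to finite ones. -/
theorem locallyFinite_support_translates {h : (Fin 2 → ℝ) → ℂ} (hs : HasCompactSupport h) :
    LocallyFinite fun m : Fin 2 → ℤ => Function.support fun x => h (x + toReal m) := by
  obtain ⟨R, hR⟩ := hs.isCompact.isBounded.subset_closedBall 0
  intro x
  refine ⟨Metric.ball x 1, Metric.ball_mem_nhds x one_pos,
    (finite_norm_toReal_le (R + (1 + ‖x‖))).subset ?_⟩
  rintro m ⟨y, hy, hyx⟩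
  have h1 : ‖y + toReal m‖ ≤ R := by simpa using hR (subset_tsupport h hy)
  have h2 : ‖y‖ ≤ 1 + ‖x‖ := by
    have := norm_le_norm_add_norm_sub' y x
    rw [mem_ball_iff_norm] at hyx
    linarith
  calc ‖toReal m‖ = ‖(y + toReal m) - y‖ := by simp
    _ ≤ ‖y + toReal m‖ + ‖y‖ := norm_sub_le _ _
    _ ≤ _ := by linarith

/-- The half-open unit square with lower corner `m`. -/
def unitBox (m : Fin 2 → ℤ) : Set (Fin 2 → ℝ) := {x | ∀ i, x i ∈ Ioc (m i : ℝ) (m i + 1)}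

theorem measurableSet_unitBox (m : Fin 2 → ℤ) : MeasurableSet (unitBox m) :=
  MeasurableSet.univ_pi' fun _ => measurableSet_Ioc

theorem mem_unitBox_iff {m : Fin 2 → ℤ} {x : Fin 2 → ℝ} :
    x ∈ unitBox m ↔ m = fun i => ⌈x i⌉ - 1 := by
  rw [funext_iff]
  refine forall_congr' fun i => ?_
  rw [eq_sub_iff_add_eq, eq_comm, Int.ceil_eq_iff, mem_Ioc]
  push_cast
  rw [add_sub_cancel_right]

theorem iUnion_unitBox : ⋃ m, unitBox m = univ :=
  eq_univ_of_forall fun _ => mem_iUnion.2 ⟨_, mem_unitBox_iff.2 rfl⟩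

theorem pairwise_disjoint_unitBox : Pairwise (Function.onFun Disjoint unitBox) :=
  fun _ _ hmn => disjoint_left.2 fun _ hm hn =>
    hmn ((mem_unitBox_iff.1 hm).trans (mem_unitBox_iff.1 hn).symm)

/-- Unfolding: the unit squares tile the plane, and each is translated back to the one at the
origin. -/
theorem hasSum_setIntegral_unitBox {F : (Fin 2 → ℝ) → ℂ} (hF : Integrable F) :
    HasSum (fun m => ∫ x in unitBox 0, F (x + toReal m)) (∫ x, F x) := by
  have h := hasSum_integral_iUnion (f := F) measurableSet_unitBox pairwise_disjoint_unitBox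
    hF.integrableOn
  rw [iUnion_unitBox, Measure.restrict_univ] at h
  refine h.congr_fun fun m => ?_
  rw [← (measurePreserving_add_right volume (toReal m)).setIntegral_preimage_emb
    (measurableEmbedding_addRight _) F (unitBox m)]
  congr 2
  ext x
  refine forall_congr' fun i => ?_
  simp only [mem_Ioc, Pi.add_apply, toReal, Pi.zero_apply, Int.cast_zero]
  constructor <;> rintro ⟨a, b⟩ <;> constructor <;> linarith

/-- **Poisson summation** for continuous functions of compact support in the plane. -/
theorem hasSum_fourier_of_hasCompactSupport {h : (Fin 2 → ℝ) → ℂ} (hc : Continuous h)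
    (hs : HasCompactSupport h)
    (hsum : Summable fun k : Fin 2 → ℤ =>
      ∫ x, Complex.exp (-((2 * Real.pi * (toReal k ⬝ᵥ x) : ℝ) : ℂ) * Complex.I) * h x) :
    HasSum (fun k : Fin 2 → ℤ =>
      ∫ x, Complex.exp (-((2 * Real.pi * (toReal k ⬝ᵥ x) : ℝ) : ℂ) * Complex.I) * h x)
      (∑' m : Fin 2 → ℤ, h (toReal m)) := by
  have hlf := locallyFinite_support_translates hs
  have hfin : ∀ x, (Function.support fun m : Fin 2 → ℤ => h (x + toReal m)).Finite :=
    fun x => hlf.point_finite x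
  let H₀ : C(Fin 2 → ℝ, ℂ) :=
    ⟨fun x => ∑' m : Fin 2 → ℤ, h (x + toReal m), by
      simp_rw [tsum_eq_finsum (hfin _)]
      exact continuous_finsum (fun m => by fun_prop) hlf⟩
  -- The periodization is invariant under integer translations, so it descends to the torus.
  have hfac : Function.FactorsThrough H₀ toTorus := by
    intro x y hxy
    obtain ⟨m, rfl⟩ := exists_toReal_of_toTorus_eq hxy
    change ∑' n : Fin 2 → ℤ, h (x + toReal n) = ∑' n : Fin 2 → ℤ, h (x + toReal m + toReal n)
    rw [← (Equiv.addLeft m).tsum_eq]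
    refine tsum_congr fun n => ?_
    rw [Equiv.coe_addLeft, toReal_add, add_assoc]
  let H : C(UnitAddTorus (Fin 2), ℂ) := isQuotientMap_toTorus.lift H₀ hfac
  have hH : ∀ x, H (toTorus x) = ∑' m : Fin 2 → ℤ, h (x + toReal m) := fun x =>
    DFunLike.congr_fun (isQuotientMap_toTorus.lift_comp H₀ hfac) x
  have hcoeff : ∀ k, UnitAddTorus.mFourierCoeff H k =
      ∫ x, Complex.exp (-((2 * Real.pi * (toReal k ⬝ᵥ x) : ℝ) : ℂ) * Complex.I) * h x := by
    intro k
    simp_rw [← mFourier_toTorus]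
    have hcont : Continuous fun x => UnitAddTorus.mFourier (-k) (toTorus x) * h x := by fun_prop
    have hF : Integrable fun x => UnitAddTorus.mFourier (-k) (toTorus x) * h x :=
      hcont.integrable_of_hasCompactSupport hs.mul_left
    rw [← (hasSum_setIntegral_unitBox hF).tsum_eq,
      UnitAddTorus.mFourierCoeff_eq_integral _ _ fun _ => 0]
    have hbox : {x : Fin 2 → ℝ | ∀ i, x i ∈ Ioc (0 : ℝ) (0 + 1)} = unitBox 0 := by
      simp [unitBox]
    rw [hbox]
    -- Only finitely many translates of the support meet the unit square, so sum and integral can be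
    -- exchanged.
    obtain ⟨S, hS⟩ : ∃ S : Finset (Fin 2 → ℤ), ∀ x ∈ unitBox 0, ∀ m ∉ S, h (x + toReal m) = 0 := by
      have := hlf.finite_nonempty_inter_compact (isCompact_Icc (a := (0 : Fin 2 → ℝ)) (b := 1))
      refine ⟨this.toFinset, fun x hx m hm => ?_⟩
      by_contra hne
      refine hm (this.mem_toFinset.2 ⟨x, hne, fun i => ?_, fun i => ?_⟩)
      · simpa using (hx i).1.le
      · simpa using (hx i).2
    simp_rw [toTorus_add_toReal]
    rw [tsum_eq_sum (s := S) fun m hm => setIntegral_eq_zero_of_forall_eq_zero fun x hx => by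
        rw [hS x hx m hm, mul_zero], ← integral_finsetSum]
    · refine setIntegral_congr_fun (measurableSet_unitBox 0) fun x hx => ?_
      change UnitAddTorus.mFourier (-k) (toTorus x) • H (toTorus x) = _
      rw [hH, tsum_eq_sum (s := S) fun m hm => hS x hx m hm, smul_eq_mul, Finset.mul_sum]
    · intro m _
      have h2 := (hF.comp_add_right (toReal m)).integrableOn (s := unitBox 0)
      simp only [toTorus_add_toReal] at h2
      exact h2
  have h1 : Summable (UnitAddTorus.mFourierCoeff H) := by
    rw [funext hcoeff]; exact hsum
  -- Summable coefficients make the Fourier series of the periodization converge pointwise; at the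
  -- origin every character is 1.
  have h2 := UnitAddTorus.hasSum_mFourier_series_apply_of_summable h1 (toTorus 0)
  rw [hH] at h2
  simp_rw [zero_add] at h2
  refine h2.congr_fun fun k => ?_
  rw [hcoeff, ← neg_neg k, mFourier_toTorus]
  simp

/-! ### Lattice points in elliptic discs -/

theorem det_inv_eq_one (hdet : A.det = 1) : A⁻¹.det = 1 := by
  rw [Matrix.det_nonsing_inv, hdet, Ring.inverse_one]

/-- This makes `√Q` a pulled-back norm, which gives the triangle inequality and the convexity of the
ellipses. -/
theorem exists_linear_quadForm (hA : A.PosDef) (hdet : A.det = 1) :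
    ∃ L : (Fin 2 → ℝ) →ₗ[ℝ] ℂ, ∀ x, √(quadForm A x) = ‖L x‖ := by
  obtain ⟨N, -, hQ, -⟩ := exists_frame hA hdet 0
  refine ⟨Complex.basisOneI.equivFun.symm.toLinearMap ∘ₗ Matrix.toLin' N, fun x => ?_⟩
  simp only [LinearMap.comp_apply, Matrix.toLin'_apply, LinearEquiv.coe_coe,
    Complex.coe_basisOneI, Module.Basis.equivFun_symm_apply, Fin.sum_univ_two, hQ]
  rw [← Complex.norm_add_mul_I]
  simp

theorem quadForm_pos (hA : A.PosDef) {x : Fin 2 → ℝ} (hx : x ≠ 0) : 0 < quadForm A x := by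
  simpa [quadForm] using hA.dotProduct_mulVec_pos hx

theorem mem_scaledEllipse_iff {r : ℝ} (hr : 0 ≤ r) {x : Fin 2 → ℝ} :
    x ∈ scaledEllipse A r ↔ √(quadForm A x) ≤ r :=
  (Real.sqrt_le_left hr).symm

theorem sqrt_quadForm_add_le (hA : A.PosDef) (hdet : A.det = 1) (x y : Fin 2 → ℝ) :
    √(quadForm A (x + y)) ≤ √(quadForm A x) + √(quadForm A y) := by
  obtain ⟨L, hL⟩ := exists_linear_quadForm hA hdet
  simp only [hL, map_add]
  exact norm_add_le _ _

theorem quadForm_neg (A : Matrix (Fin 2) (Fin 2) ℝ) (x : Fin 2 → ℝ) :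
    quadForm A (-x) = quadForm A x := by
  simp [quadForm_apply]

theorem quadForm_smul (A : Matrix (Fin 2) (Fin 2) ℝ) (t : ℝ) (x : Fin 2 → ℝ) :
    quadForm A (t • x) = t ^ 2 * quadForm A x := by
  simp [quadForm_apply]; ring

theorem convex_scaledEllipse (hA : A.PosDef) (hdet : A.det = 1) {r : ℝ} (hr : 0 ≤ r) :
    Convex ℝ (scaledEllipse A r) := by
  obtain ⟨L, hL⟩ := exists_linear_quadForm hA hdet
  have : scaledEllipse A r = L ⁻¹' Metric.closedBall 0 r := by
    ext x
    rw [mem_scaledEllipse_iff hr, hL]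
    simp
  rw [this]
  exact (convex_closedBall 0 r).linear_preimage L

theorem norm_le_of_mem_scaledEllipse (hA : A.PosDef) (hdet : A.det = 1) {r : ℝ} (hr : 0 ≤ r)
    {x : Fin 2 → ℝ} (hx : x ∈ scaledEllipse A r) : ‖x‖ ≤ √(A 0 0 + A 1 1) * r := by
  have ha : 0 < A 0 0 := hA.diag_pos
  have hd : 0 < A 1 1 := hA.diag_pos
  have hsym := isSymm_entry hA
  rw [Matrix.det_fin_two, hsym] at hdet
  have hQ : quadForm A x ≤ r ^ 2 := hx
  rw [quadForm_apply, hsym] at hQ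
  -- Since `det A = 1`, `A 1 1 * Q(x) = (A 0 1 * x 0 + A 1 1 * x 1)² + x 0²`.
  have h0 : x 0 ^ 2 ≤ A 1 1 * r ^ 2 := by
    nlinarith [sq_nonneg (A 0 1 * x 0 + A 1 1 * x 1), mul_le_mul_of_nonneg_left hQ hd.le]
  have h1 : x 1 ^ 2 ≤ A 0 0 * r ^ 2 := by
    nlinarith [sq_nonneg (A 0 0 * x 0 + A 0 1 * x 1), mul_le_mul_of_nonneg_left hQ ha.le]
  have hs : (√(A 0 0 + A 1 1) * r) ^ 2 = (A 0 0 + A 1 1) * r ^ 2 := by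
    rw [mul_pow, Real.sq_sqrt (by positivity)]
  refine (pi_norm_le_iff_of_nonneg (by positivity)).2 fun i => ?_
  refine abs_le_of_sq_le_sq ?_ (by positivity)
  rw [hs]
  fin_cases i
  · simp only [Fin.zero_eta]; nlinarith [sq_nonneg r]
  · simp only [Fin.mk_one]; nlinarith [sq_nonneg r]

theorem isCompact_scaledEllipse (hA : A.PosDef) (hdet : A.det = 1) {r : ℝ} (hr : 0 ≤ r) :
    IsCompact (scaledEllipse A r) :=
  (isCompact_closedBall (0 : Fin 2 → ℝ) (√(A 0 0 + A 1 1) * r)).of_isClosed_subset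
    (isClosed_scaledEllipse A r) fun x hx => by
      simpa using norm_le_of_mem_scaledEllipse hA hdet hr hx

theorem finite_toReal_mem_scaledEllipse (hA : A.PosDef) (hdet : A.det = 1) {r : ℝ} (hr : 0 ≤ r) :
    {m : Fin 2 → ℤ | toReal m ∈ scaledEllipse A r}.Finite :=
  (finite_norm_toReal_le _).subset fun _ hm => norm_le_of_mem_scaledEllipse hA hdet hr hm

theorem latticePoints_ellipse {t : ℝ} (ht : 0 < t) :
    latticePoints (ellipse A) t = {m | toReal m ∈ scaledEllipse A t} := by
  ext m
  simp only [latticePoints, mem_ofPred_eq, mem_smul_set_iff_inv_smul_mem₀ ht.ne', ellipse,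
    quadForm_smul, scaledEllipse]
  rw [inv_pow, inv_mul_le_iff₀ (by positivity), mul_one]

theorem toReal_ne_zero {k : Fin 2 → ℤ} (hk : k ≠ 0) : toReal k ≠ 0 := fun h =>
  hk (funext fun i => by simpa [toReal] using congrFun h i)

theorem supportFn_pos (hA : A.PosDef) {k : Fin 2 → ℤ} (hk : k ≠ 0) :
    0 < supportFn A (toReal k) :=
  Real.sqrt_pos.2 (quadForm_pos hA.inv (toReal_ne_zero hk))

theorem supportFn_le_iff {u : ℝ} (hu : 0 ≤ u) (x : Fin 2 → ℝ) :
    supportFn A x ≤ u ↔ x ∈ scaledEllipse A⁻¹ u :=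
  (mem_scaledEllipse_iff hu).symm

/-- Only finitely many lattice points satisfy `g(k) ≤ g(1,1)`, so the minimum is attained among
them. -/
theorem exists_isLeast_latticeValues (hA : A.PosDef) (hdet : A.det = 1) :
    ∃ k : Fin 2 → ℤ, k ≠ 0 ∧ IsLeast (latticeValues A) (supportFn A (toReal k)) := by
  have h1 : (fun _ => 1 : Fin 2 → ℤ) ≠ 0 := fun h => one_ne_zero (congrFun h 0)
  have hpos := supportFn_pos hA h1
  have hfin : {k : Fin 2 → ℤ | k ≠ 0 ∧ supportFn A (toReal k) ≤
      supportFn A (toReal fun _ => 1)}.Finite :=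
    (finite_toReal_mem_scaledEllipse hA.inv (det_inv_eq_one hdet) hpos.le).subset
      fun k hk => (supportFn_le_iff hpos.le _).1 hk.2
  obtain ⟨k, hk, hmin⟩ := Set.exists_min_image _ (fun k => supportFn A (toReal k)) hfin
    ⟨_, h1, le_rfl⟩
  refine ⟨k, hk.1, ⟨k, hk.1, rfl⟩, ?_⟩
  rintro _ ⟨l, hl, rfl⟩
  rcases le_total (supportFn A (toReal l)) (supportFn A (toReal fun _ => 1)) with h | h
  · exact hmin l ⟨hl, h⟩
  · exact hk.2.trans h

theorem isLeast_minG (hA : A.PosDef) (hdet : A.det = 1) :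
    IsLeast (latticeValues A) (minG A) := by
  obtain ⟨k, -, hk⟩ := exists_isLeast_latticeValues hA hdet
  rwa [minG, hk.csInf_eq]

theorem minG_pos (hA : A.PosDef) (hdet : A.det = 1) : 0 < minG A := by
  obtain ⟨k, hk, h⟩ := (isLeast_minG hA hdet).1
  rw [h]; exact supportFn_pos hA hk

theorem continuous_supportFn (A : Matrix (Fin 2) (Fin 2) ℝ) : Continuous (supportFn A) :=
  (continuous_quadForm _).sqrt

theorem isGreatest_maxG (A : Matrix (Fin 2) (Fin 2) ℝ) :
    IsGreatest (squareValues A) (maxG A) := by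
  have hc : IsCompact (Icc (fun _ => -(1 / 2) : Fin 2 → ℝ) fun _ => 1 / 2) := isCompact_Icc
  obtain ⟨w, hw, hmax⟩ := hc.exists_isMaxOn ⟨0, ⟨fun _ => by simp, fun _ => by simp⟩⟩
    (continuous_supportFn A).continuousOn
  have : IsGreatest (squareValues A) (supportFn A w) := by
    refine ⟨⟨w, fun i => ⟨hw.1 i, hw.2 i⟩, rfl⟩, ?_⟩
    rintro _ ⟨v, hv, rfl⟩
    exact hmax ⟨fun i => (hv i).1, fun i => (hv i).2⟩
  rwa [maxG, this.csSup_eq]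

theorem maxG_nonneg (A : Matrix (Fin 2) (Fin 2) ℝ) : 0 ≤ maxG A := by
  obtain ⟨w, -, h⟩ := (isGreatest_maxG A).1
  rw [h]; exact Real.sqrt_nonneg _

theorem volume_unitBox (m : Fin 2 → ℤ) : volume (unitBox m) = 1 := by
  have : unitBox m = univ.pi fun i => Ioc (m i : ℝ) (m i + 1) := by
    ext x; simp [unitBox]
  rw [this, volume_pi_pi]
  simp

/-- The number of nonzero lattice points with `g ≤ u` is at most `a_g(u)`. -/
theorem card_le_aFn (hA : A.PosDef) (hdet : A.det = 1) {u : ℝ} (hu : 0 < u)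
    (S : Finset (Fin 2 → ℤ)) (hS : ∀ k ∈ S, k ≠ 0 ∧ supportFn A (toReal k) ≤ u) :
    (S.card : ℝ) ≤ aFn A u := by
  have hG := maxG_nonneg A
  have hr : 0 < u + maxG A := by linarith
  -- The shift centres the unit squares at lattice points, so each reaches at most `G₁` from its
  -- centre. The square at the origin is packed too, which yields the `-1` in `a_g`.
  let c : Fin 2 → ℝ := fun _ => 1 / 2
  have hmp := measurePreserving_add_right volume c
  have hsub : (⋃ m ∈ insert 0 S, (· + c) ⁻¹' unitBox m) ⊆ scaledEllipse A⁻¹ (u + maxG A) := by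
    refine iUnion₂_subset fun m hm x hx => ?_
    rw [← supportFn_le_iff hr.le]
    have h1 : supportFn A (toReal m) ≤ u := by
      rcases Finset.mem_insert.1 hm with rfl | hm
      · simpa [supportFn, toReal_zero, quadForm] using hu.le
      · exact (hS m hm).2
    have h2 : supportFn A (x - toReal m) ≤ maxG A := by
      refine (isGreatest_maxG A).2 ⟨_, fun i => ?_, rfl⟩
      have := hx i
      simp only [Pi.add_apply, mem_Ioc, c] at this
      simp only [Pi.sub_apply, toReal, mem_Icc]
      constructor <;> linarith [this.1, this.2]
    calc supportFn A x = supportFn A (toReal m + (x - toReal m)) := by rw [add_sub_cancel]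
      _ ≤ supportFn A (toReal m) + supportFn A (x - toReal m) :=
        sqrt_quadForm_add_le hA.inv (det_inv_eq_one hdet) _ _
      _ ≤ _ := add_le_add h1 h2
  have hcard : volume.real (⋃ m ∈ insert 0 S, (· + c) ⁻¹' unitBox m) = (S.card : ℝ) + 1 := by
    have hv : ∀ m : Fin 2 → ℤ, volume ((· + c) ⁻¹' unitBox m) = 1 := fun m => by
      rw [hmp.measure_preimage (measurableSet_unitBox m).nullMeasurableSet, volume_unitBox]
    rw [measureReal_biUnion_finset (fun m _ n _ hmn => (pairwise_disjoint_unitBox hmn).preimage _)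
      (fun m _ => hmp.measurable (measurableSet_unitBox m))
      (fun m _ => by rw [hv]; exact ENNReal.one_ne_top)]
    simp_rw [measureReal_def, hv]
    rw [Finset.sum_const, Finset.card_insert_of_notMem fun h => (hS 0 h).1 rfl]
    simp
  have hle := measureReal_mono (μ := volume) hsub
    (isCompact_scaledEllipse hA.inv (det_inv_eq_one hdet) hr.le).measure_ne_top
  rw [hcard, volume_real_scaledEllipse hA.inv (det_inv_eq_one hdet) hr] at hle
  rw [aFn]; linarith

theorem aFn_nonneg (hA : A.PosDef) (hdet : A.det = 1) {u : ℝ} (hu : 0 < u) : 0 ≤ aFn A u := by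
  simpa using card_le_aFn hA hdet hu ∅ (by simp)

/-! ### Smoothing -/

variable {S T : Set (Fin 2 → ℝ)}

/-- The convolution of the indicator functions of `S` and `T`. -/
def overlap (S T : Set (Fin 2 → ℝ)) (x : Fin 2 → ℝ) : ℝ := volume.real {y | y ∈ S ∧ x - y ∈ T}

theorem overlap_nonneg (S T : Set (Fin 2 → ℝ)) (x : Fin 2 → ℝ) : 0 ≤ overlap S T x :=
  measureReal_nonneg

theorem overlap_le (hS : IsCompact S) (T : Set (Fin 2 → ℝ)) (x : Fin 2 → ℝ) :
    overlap S T x ≤ volume.real S :=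
  measureReal_mono (fun _ hy => hy.1) hS.measure_ne_top

theorem overlap_eq_of_forall_mem {x : Fin 2 → ℝ} (h : ∀ y ∈ S, x - y ∈ T) :
    overlap S T x = volume.real S := by
  rw [overlap]
  congr 1
  ext y
  exact ⟨fun h => h.1, fun hy => ⟨hy, h y hy⟩⟩

theorem overlap_eq_zero {x : Fin 2 → ℝ} (h : ∀ y ∈ S, x - y ∉ T) : overlap S T x = 0 := by
  have : {y | y ∈ S ∧ x - y ∈ T} = ∅ := by
    ext y; simpa using h y
  rw [overlap, this, measureReal_empty]

theorem overlap_eq_integral (hS : MeasurableSet S) (hT : MeasurableSet T) (x : Fin 2 → ℝ) :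
    (overlap S T x : ℂ) =
      ∫ y, S.indicator (fun _ => (1 : ℂ)) y * T.indicator (fun _ => (1 : ℂ)) (x - y) := by
  have hm : MeasurableSet {y | y ∈ S ∧ x - y ∈ T} :=
    hS.inter (measurable_const.sub measurable_id hT)
  have : (fun y => S.indicator (fun _ => (1 : ℂ)) y * T.indicator (fun _ => (1 : ℂ)) (x - y)) =
      {y | y ∈ S ∧ x - y ∈ T}.indicator fun _ => 1 := by
    ext y
    by_cases h1 : y ∈ S <;> by_cases h2 : x - y ∈ T <;> simp [h1, h2]
  rw [this, integral_indicator hm, setIntegral_const, overlap, Complex.real_smul, mul_one]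

theorem integrable_indicator_one (hS : IsCompact S) :
    Integrable (S.indicator fun _ => (1 : ℂ)) := by
  rw [integrable_indicator_iff hS.measurableSet]
  exact integrableOn_const hS.measure_ne_top

/-- Dominated convergence: for fixed `x`, almost every `y` has `x - y` off the null boundary of `T`,
where the indicator is continuous. -/
theorem continuous_overlap (hS : IsCompact S) (hT : IsCompact T) (hT0 : volume (frontier T) = 0) :
    Continuous fun x => (overlap S T x : ℂ) := by
  simp_rw [overlap_eq_integral hS.measurableSet hT.measurableSet]
  rw [continuous_iff_continuousAt]
  intro x
  have hTm := hT.measurableSet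
  refine continuousAt_of_dominated (bound := fun y => ‖S.indicator (fun _ => (1 : ℂ)) y‖)
    (Eventually.of_forall fun z => ?_) (Eventually.of_forall fun z => Eventually.of_forall
      fun y => ?_) (integrable_indicator_one hS).norm ?_
  · have h1 : Measurable fun y => T.indicator (fun _ => (1 : ℂ)) (z - y) :=
      (measurable_const.indicator hTm).comp (measurable_const.sub measurable_id)
    exact ((measurable_const.indicator hS.measurableSet).mul h1).aestronglyMeasurable
  · rw [norm_mul]
    refine mul_le_of_le_one_right (norm_nonneg _) ?_
    by_cases h : z - y ∈ T <;> simp [h]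
  · have hae : ∀ᵐ y, x - y ∉ frontier T :=
      (Measure.measurePreserving_sub_left volume x).quasiMeasurePreserving.ae
        (measure_eq_zero_iff_ae_notMem.1 hT0)
    filter_upwards [hae] with y hy
    refine continuousAt_const.mul ?_
    have h1 : ContinuousAt (T.indicator fun _ => (1 : ℂ)) (x - y) :=
      continuousOn_const.continuousAt_indicator hy
    exact ContinuousAt.comp (f := fun z => z - y) h1 (by fun_prop)

theorem hasCompactSupport_overlap (hS : IsCompact S) (hT : IsCompact T) :
    HasCompactSupport fun x => (overlap S T x : ℂ) := by
  refine HasCompactSupport.intro (hS.add hT) fun x hx => ?_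
  rw [overlap_eq_zero, Complex.ofReal_zero]
  exact fun y hy h => hx ⟨y, hy, x - y, h, by simp⟩

/-- The character satisfies `e(x) = e(y) e(x - y)`, so it can be absorbed into the two indicators;
the integral of a convolution is the product of the integrals. -/
theorem fourier_overlap (hS : IsCompact S) (hT : IsCompact T) (k : Fin 2 → ℝ) :
    ∫ x, Complex.exp (-((2 * Real.pi * (k ⬝ᵥ x) : ℝ) : ℂ) * Complex.I) * (overlap S T x : ℂ) =
      indicatorFourier S k * indicatorFourier T k := by
  let e : (Fin 2 → ℝ) → ℂ := fun x => Complex.exp (-((2 * Real.pi * (k ⬝ᵥ x) : ℝ) : ℂ) * Complex.I)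
  have he : Continuous e := by
    simp only [e, dotProduct, Fin.sum_univ_two]; fun_prop
  have hadd : ∀ x y, e x = e y * e (x - y) := by
    intro x y
    simp only [e]
    rw [← Complex.exp_add, dotProduct_sub]
    congr 1; push_cast; ring
  have hint : ∀ U : Set (Fin 2 → ℝ), IsCompact U → Integrable (U.indicator e) := fun U hU => by
    rw [integrable_indicator_iff hU.measurableSet]
    exact he.continuousOn.integrableOn_compact hU
  have h := integral_convolution (μ := volume) (ν := volume) (ContinuousLinearMap.mul ℂ ℂ)
    (hint S hS) (hint T hT)
  rw [integral_indicator hS.measurableSet, integral_indicator hT.measurableSet] at h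
  refine Eq.trans ?_ h
  refine integral_congr_ae (Eventually.of_forall fun x => ?_)
  simp only [convolution_def, ContinuousLinearMap.mul_apply']
  rw [overlap_eq_integral hS.measurableSet hT.measurableSet, ← integral_const_mul]
  refine integral_congr_ae (Eventually.of_forall fun y => ?_)
  change e x * _ = _
  simp only
  rw [hadd x y]
  by_cases h1 : y ∈ S <;> by_cases h2 : x - y ∈ T <;> simp [h1, h2]

/-- Poisson summation for the convolution; frequency zero contributes the product of the areas and
is moved to the left. -/
theorem abs_tsum_overlap_sub_le (hS : IsCompact S) (hT : IsCompact T)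
    (hT0 : volume (frontier T) = 0) {B : (Fin 2 → ℤ) → ℝ} (hB : Summable B) (hB0 : 0 ≤ B 0)
    (h : ∀ k ≠ 0, ‖indicatorFourier S (toReal k)‖ * ‖indicatorFourier T (toReal k)‖ ≤ B k) :
    |∑' m : Fin 2 → ℤ, overlap S T (toReal m) - volume.real S * volume.real T| ≤ ∑' k, B k := by
  have hF : Summable fun k : Fin 2 → ℤ =>
      ∫ x, Complex.exp (-((2 * Real.pi * (toReal k ⬝ᵥ x) : ℝ) : ℂ) * Complex.I) *
        (overlap S T x : ℂ) := by
    simp_rw [fourier_overlap hS hT]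
    refine Summable.of_norm_bounded_eventually hB ?_
    filter_upwards [(Set.finite_singleton (0 : Fin 2 → ℤ)).compl_mem_cofinite] with k hk
    rw [norm_mul]
    exact h k hk
  have hsum := hasSum_fourier_of_hasCompactSupport (continuous_overlap hS hT hT0)
    (hasCompactSupport_overlap hS hT) hF
  simp_rw [fourier_overlap hS hT] at hsum
  have h1 := hasSum_ite_sub_hasSum hsum 0
  have h2 := tsum_of_norm_bounded (f := fun k : Fin 2 → ℤ => if k = 0 then 0 else
    indicatorFourier S (toReal k) * indicatorFourier T (toReal k)) hB.hasSum fun k => by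
      split_ifs with hk
      · simpa [hk] using hB0
      · rw [norm_mul]; exact h k hk
  rw [h1.tsum_eq, toReal_zero, indicatorFourier_zero, indicatorFourier_zero, ← Complex.ofReal_tsum,
    ← Complex.ofReal_mul, ← Complex.ofReal_sub, Complex.norm_real] at h2
  exact h2

theorem sqrt_quadForm_neg (A : Matrix (Fin 2) (Fin 2) ℝ) (x : Fin 2 → ℝ) :
    √(quadForm A (-x)) = √(quadForm A x) := by
  rw [quadForm_neg]

/-- The lattice point count is at most the smoothed count of a larger ellipse. -/
theorem ncard_mul_le_tsum_overlap (hA : A.PosDef) (hdet : A.det = 1) {t ε : ℝ} (ht : 0 < t)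
    (hε : 0 < ε) :
    ((latticePoints (ellipse A) t).ncard : ℝ) * volume.real (scaledEllipse A ε) ≤
      ∑' m : Fin 2 → ℤ, overlap (scaledEllipse A ε) (scaledEllipse A (t + ε)) (toReal m) := by
  have hfin := finite_toReal_mem_scaledEllipse hA hdet ht.le
  rw [latticePoints_ellipse ht, Set.ncard_eq_toFinset_card _ hfin]
  have hS := isCompact_scaledEllipse hA hdet hε.le
  have hT := isCompact_scaledEllipse hA hdet (add_pos ht hε).le
  have hsum : Summable fun m : Fin 2 → ℤ =>
      overlap (scaledEllipse A ε) (scaledEllipse A (t + ε)) (toReal m) := by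
    have := (locallyFinite_support_translates (hasCompactSupport_overlap hS hT)).point_finite 0
    refine summable_of_hasFiniteSupport (this.subset fun m hm => ?_)
    simpa using hm
  refine le_trans (le_of_eq ?_) (hsum.sum_le_tsum hfin.toFinset fun m _ => overlap_nonneg _ _ _)
  rw [Finset.sum_congr rfl fun m hm => overlap_eq_of_forall_mem fun y hy => ?_, Finset.sum_const,
    nsmul_eq_mul]
  rw [Set.Finite.mem_toFinset, mem_ofPred_eq, mem_scaledEllipse_iff ht.le] at hm
  rw [mem_scaledEllipse_iff hε.le] at hy
  rw [mem_scaledEllipse_iff (add_pos ht hε).le, sub_eq_add_neg]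
  refine (sqrt_quadForm_add_le hA hdet _ _).trans ?_
  rw [sqrt_quadForm_neg]
  exact add_le_add hm hy

/-- The lattice point count is at least the smoothed count of a smaller ellipse. -/
theorem tsum_overlap_le_ncard_mul (hA : A.PosDef) (hdet : A.det = 1) {t ε : ℝ} (hε : 0 < ε)
    (ht : ε < t) :
    ∑' m : Fin 2 → ℤ, overlap (scaledEllipse A ε) (scaledEllipse A (t - ε)) (toReal m) ≤
      ((latticePoints (ellipse A) t).ncard : ℝ) * volume.real (scaledEllipse A ε) := by
  have ht0 : 0 < t := hε.trans ht
  have hfin := finite_toReal_mem_scaledEllipse hA hdet ht0.le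
  rw [latticePoints_ellipse ht0, Set.ncard_eq_toFinset_card _ hfin]
  have hS := isCompact_scaledEllipse hA hdet hε.le
  rw [tsum_eq_sum (s := hfin.toFinset)]
  · rw [← nsmul_eq_mul]
    exact Finset.sum_le_card_nsmul _ _ _ fun m _ => overlap_le hS _ _
  · intro m hm
    refine overlap_eq_zero fun y hy h => hm ?_
    rw [Set.Finite.mem_toFinset, mem_ofPred_eq, mem_scaledEllipse_iff ht0.le]
    rw [mem_scaledEllipse_iff hε.le] at hy
    rw [mem_scaledEllipse_iff (sub_pos.2 ht).le] at h
    calc √(quadForm A (toReal m)) = √(quadForm A (y + (toReal m - y))) := by rw [add_sub_cancel]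
      _ ≤ _ := sqrt_quadForm_add_le hA hdet _ _
      _ ≤ t := by linarith

/-! ### Summation by parts -/

/-- Minus the derivative of `v ↦ v ^ (-3/2) * min 1 ((K / v) ^ (3/2))`. -/
def weight (K u : ℝ) : ℝ :=
  if u ≤ K then 3 / 2 * u ^ (-(5 / 2) : ℝ) else 3 * K ^ (3 / 2 : ℝ) * u ^ (-4 : ℝ)

theorem weight_nonneg {K u : ℝ} (hK : 0 < K) (hu : 0 < u) : 0 ≤ weight K u := by
  unfold weight; split_ifs <;> positivity

theorem integral_weight_mul {v K : ℝ} (hvK : v ≤ K) {w : ℝ → ℝ}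
    (h1 : IntervalIntegrable (fun u => u ^ (-(5 / 2) : ℝ) * w u) volume v K)
    (h2 : IntegrableOn (fun u => u ^ (-4 : ℝ) * w u) (Ioi K)) :
    IntegrableOn (fun u => weight K u * w u) (Ioi v) ∧
    ∫ u in Ioi v, weight K u * w u = 3 / 2 * (∫ u in v..K, u ^ (-(5 / 2) : ℝ) * w u) +
      3 * K ^ (3 / 2 : ℝ) * ∫ u in Ioi K, u ^ (-4 : ℝ) * w u := by
  have e1 : EqOn (fun u => weight K u * w u) (fun u => 3 / 2 * (u ^ (-(5 / 2) : ℝ) * w u))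
      (Ioc v K) := fun u hu => by
    simp only [weight, if_pos hu.2]; ring
  have e2 : EqOn (fun u => weight K u * w u)
      (fun u => 3 * K ^ (3 / 2 : ℝ) * (u ^ (-4 : ℝ) * w u)) (Ioi K) := fun u hu => by
    simp only [weight, if_neg (not_le.2 (mem_Ioi.1 hu))]; ring
  have i1 : IntegrableOn (fun u => weight K u * w u) (Ioc v K) :=
    (integrableOn_congr_fun e1 measurableSet_Ioc).2
      (((intervalIntegrable_iff_integrableOn_Ioc_of_le hvK).1 h1).const_mul _)
  have i2 : IntegrableOn (fun u => weight K u * w u) (Ioi K) :=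
    (integrableOn_congr_fun e2 measurableSet_Ioi).2 (h2.const_mul _)
  rw [← Ioc_union_Ioi_eq_Ioi hvK]
  refine ⟨i1.union i2, ?_⟩
  rw [setIntegral_union (Ioc_disjoint_Ioi le_rfl) measurableSet_Ioi i1 i2,
    setIntegral_congr_fun measurableSet_Ioc e1, setIntegral_congr_fun measurableSet_Ioi e2,
    integral_const_mul, integral_const_mul, intervalIntegral.integral_of_le hvK]

theorem zero_notMem_uIcc {v K : ℝ} (hv : 0 < v) (hvK : v ≤ K) : (0 : ℝ) ∉ uIcc v K := by
  rw [uIcc_of_le hvK]; exact fun h => hv.not_ge h.1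

/-- Each term of the frequency sum is written as a tail integral of `weight`, the form needed for
Abel summation. -/
theorem integral_weight {v K : ℝ} (hv : 0 < v) (hK : 0 < K) :
    IntegrableOn (weight K) (Ioi v) ∧
    ∫ u in Ioi v, weight K u = v ^ (-(3 / 2) : ℝ) * min 1 ((K / v) ^ (3 / 2 : ℝ)) := by
  have hI : ∀ c : ℝ, 0 < c → ∫ u in Ioi c, u ^ (-4 : ℝ) = c ^ (-3 : ℝ) / 3 := fun c hc => by
    rw [integral_Ioi_rpow_of_lt (by norm_num) hc]
    norm_num [neg_div_neg_eq]
  rcases le_or_gt v K with hvK | hvK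
  · have h0 := zero_notMem_uIcc hv hvK
    have h := integral_weight_mul hvK (w := fun _ => 1)
      (by simpa using intervalIntegral.intervalIntegrable_rpow (Or.inr h0))
      (by simpa using integrableOn_Ioi_rpow_of_lt (a := -4) (by norm_num) hK)
    simp only [mul_one] at h
    refine ⟨h.1, ?_⟩
    have hle : 1 ≤ (K / v) ^ (3 / 2 : ℝ) :=
      Real.one_le_rpow ((one_le_div hv).2 hvK) (by norm_num)
    have e : K ^ (3 / 2 : ℝ) * K ^ (-3 : ℝ) = K ^ (-(3 / 2) : ℝ) := by
      rw [← Real.rpow_add hK]; norm_num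
    rw [h.2, min_eq_left hle, hI K hK, integral_rpow (Or.inr ⟨by norm_num, h0⟩),
      show -(5 / 2) + 1 = (-(3 / 2) : ℝ) by norm_num]
    linear_combination e
  · have e2 : EqOn (weight K) (fun u => 3 * K ^ (3 / 2 : ℝ) * u ^ (-4 : ℝ)) (Ioi v) :=
      fun u hu => by simp only [weight, if_neg (not_le.2 (hvK.trans hu))]
    refine ⟨(integrableOn_congr_fun e2 measurableSet_Ioi).2
      ((integrableOn_Ioi_rpow_of_lt (by norm_num) hv).const_mul _), ?_⟩
    have hle : (K / v) ^ (3 / 2 : ℝ) ≤ 1 :=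
      Real.rpow_le_one (by positivity) ((div_le_one hv).2 hvK.le) (by norm_num)
    have e : v ^ (-3 : ℝ) = v ^ (-(3 / 2) : ℝ) * v ^ (-(3 / 2) : ℝ) := by
      rw [← Real.rpow_add hv]; norm_num
    rw [setIntegral_congr_fun measurableSet_Ioi e2, integral_const_mul, hI v hv,
      min_eq_right hle, Real.div_rpow hK.le hv.le, e, div_eq_mul_inv (K ^ _), ← Real.rpow_neg hv.le]
    ring

theorem integral_rpow_mul_aFn (A : Matrix (Fin 2) (Fin 2) ℝ) {v K : ℝ} (hv : 0 < v) (hvK : v ≤ K) :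
    IntervalIntegrable (fun u => u ^ (-(5 / 2) : ℝ) * aFn A u) volume v K ∧
    ∫ u in v..K, u ^ (-(5 / 2) : ℝ) * aFn A u =
      Real.pi * (2 * (K ^ (1 / 2 : ℝ) - v ^ (1 / 2 : ℝ))) +
      2 * Real.pi * maxG A * (2 * (v ^ (-(1 / 2) : ℝ) - K ^ (-(1 / 2) : ℝ))) +
      (Real.pi * maxG A ^ 2 - 1) * (2 / 3 * (v ^ (-(3 / 2) : ℝ) - K ^ (-(3 / 2) : ℝ))) := by
  have h0 := zero_notMem_uIcc hv hvK
  have e : EqOn (fun u => u ^ (-(5 / 2) : ℝ) * aFn A u) (fun u =>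
      Real.pi * u ^ (-(1 / 2) : ℝ) + 2 * Real.pi * maxG A * u ^ (-(3 / 2) : ℝ) +
      (Real.pi * maxG A ^ 2 - 1) * u ^ (-(5 / 2) : ℝ)) (uIcc v K) := fun u hu => by
    rw [uIcc_of_le hvK] at hu
    have hu0 : 0 < u := hv.trans_le hu.1
    have e1 : u ^ (-(1 / 2) : ℝ) = u ^ (-(5 / 2) : ℝ) * u ^ 2 := by
      rw [← Real.rpow_natCast u 2, ← Real.rpow_add hu0]; norm_num
    have e2 : u ^ (-(3 / 2) : ℝ) = u ^ (-(5 / 2) : ℝ) * u := by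
      nth_rw 3 [← Real.rpow_one u]
      rw [← Real.rpow_add hu0]; norm_num
    simp only [aFn, e1, e2]; ring
  have hI : ∀ r : ℝ, IntervalIntegrable (fun u : ℝ => u ^ r) volume v K := fun r =>
    intervalIntegral.intervalIntegrable_rpow (Or.inr h0)
  constructor
  · exact (((hI _).const_mul _).add ((hI _).const_mul _)).add ((hI _).const_mul _) |>.congr
      fun u hu => (e (uIoc_subset_uIcc hu)).symm
  · rw [intervalIntegral.integral_congr e, intervalIntegral.integral_add
      (((hI _).const_mul _).add ((hI _).const_mul _)) ((hI _).const_mul _),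
      intervalIntegral.integral_add ((hI _).const_mul _) ((hI _).const_mul _)]
    simp only [intervalIntegral.integral_const_mul]
    rw [integral_rpow (Or.inr ⟨by norm_num, h0⟩), integral_rpow (Or.inr ⟨by norm_num, h0⟩),
      integral_rpow (Or.inr ⟨by norm_num, h0⟩),
      show -(5 / 2) + 1 = (-(3 / 2) : ℝ) by norm_num, show -(3 / 2) + 1 = (-(1 / 2) : ℝ) by norm_num,
      show -(1 / 2) + 1 = (1 / 2 : ℝ) by norm_num]
    ring

theorem integral_Ioi_rpow_mul_aFn (A : Matrix (Fin 2) (Fin 2) ℝ) {K : ℝ} (hK : 0 < K) :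
    IntegrableOn (fun u => u ^ (-4 : ℝ) * aFn A u) (Ioi K) ∧
    ∫ u in Ioi K, u ^ (-4 : ℝ) * aFn A u =
      Real.pi * K ^ (-1 : ℝ) + 2 * Real.pi * maxG A * (K ^ (-2 : ℝ) / 2) +
      (Real.pi * maxG A ^ 2 - 1) * (K ^ (-3 : ℝ) / 3) := by
  have e : EqOn (fun u => u ^ (-4 : ℝ) * aFn A u) (fun u =>
      Real.pi * u ^ (-2 : ℝ) + 2 * Real.pi * maxG A * u ^ (-3 : ℝ) +
      (Real.pi * maxG A ^ 2 - 1) * u ^ (-4 : ℝ)) (Ioi K) := fun u hu => by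
    have hu0 : 0 < u := hK.trans hu
    have e1 : u ^ (-2 : ℝ) = u ^ (-4 : ℝ) * u ^ 2 := by
      rw [← Real.rpow_natCast u 2, ← Real.rpow_add hu0]; norm_num
    have e2 : u ^ (-3 : ℝ) = u ^ (-4 : ℝ) * u := by
      nth_rw 3 [← Real.rpow_one u]
      rw [← Real.rpow_add hu0]; norm_num
    simp only [aFn, e1, e2]; ring
  have hI : ∀ r : ℝ, r < -1 → IntegrableOn (fun u : ℝ => u ^ r) (Ioi K) := fun r hr =>
    integrableOn_Ioi_rpow_of_lt hr hK
  have h2 := (hI (-2) (by norm_num)).const_mul Real.pi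
  have h3 := (hI (-3) (by norm_num)).const_mul (2 * Real.pi * maxG A)
  have h4 := (hI (-4) (by norm_num)).const_mul (Real.pi * maxG A ^ 2 - 1)
  constructor
  · exact (integrableOn_congr_fun e measurableSet_Ioi).2 ((h2.add h3).add h4)
  · rw [setIntegral_congr_fun measurableSet_Ioi e,
      integral_add (f := fun u => Real.pi * u ^ (-2 : ℝ) + 2 * Real.pi * maxG A * u ^ (-3 : ℝ))
        (h2.add h3) h4, integral_add h2 h3]
    simp only [integral_const_mul]
    rw [integral_Ioi_rpow_of_lt (by norm_num) hK, integral_Ioi_rpow_of_lt (by norm_num) hK,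
      integral_Ioi_rpow_of_lt (by norm_num) hK,
      show (-4 + 1 : ℝ) = -3 by norm_num, show (-3 + 1 : ℝ) = -2 by norm_num,
      show (-2 + 1 : ℝ) = -1 by norm_num]
    ring

/-- The integral that bounds the sum of `g ^ (-3/2) * min 1 ((K / g) ^ (3/2))`. -/
def weightIntegral (A : Matrix (Fin 2) (Fin 2) ℝ) (K : ℝ) : ℝ :=
  3 / 2 * (∫ u in (minG A)..K, u ^ (-(5 / 2) : ℝ) * aFn A u) +
    3 * K ^ (3 / 2 : ℝ) * ∫ u in Ioi K, u ^ (-4 : ℝ) * aFn A u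

/-- Abel summation in integral form: each term is the integral of `weight` over `u > g(k)`. Under
the integral sign the sum becomes `weight` times a lattice count, and the count is at most `a_g(u)`.
-/
theorem sum_le_weightIntegral (hA : A.PosDef) (hdet : A.det = 1) {K : ℝ} (hK : minG A ≤ K)
    (S : Finset (Fin 2 → ℤ)) (hS : ∀ k ∈ S, k ≠ 0) :
    ∑ k ∈ S, supportFn A (toReal k) ^ (-(3 / 2) : ℝ) *
      min 1 ((K / supportFn A (toReal k)) ^ (3 / 2 : ℝ)) ≤ weightIntegral A K := by
  have hG := minG_pos hA hdet
  have hK0 := hG.trans_le hK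
  obtain ⟨hint, heq⟩ := integral_weight_mul hK (integral_rpow_mul_aFn A hG hK).1
    (integral_Ioi_rpow_mul_aFn A hK0).1
  have hgk : ∀ k ∈ S, minG A ≤ supportFn A (toReal k) := fun k hk =>
    (isLeast_minG hA hdet).2 ⟨k, hS k hk, rfl⟩
  have hk1 : ∀ k ∈ S, IntegrableOn ((Ioi (supportFn A (toReal k))).indicator (weight K))
      (Ioi (minG A)) := fun k hk => by
    exact ((integrable_indicator_iff measurableSet_Ioi).2
      (integral_weight (supportFn_pos hA (hS k hk)) hK0).1).integrableOn
  have hk2 : ∀ k ∈ S, supportFn A (toReal k) ^ (-(3 / 2) : ℝ) *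
      min 1 ((K / supportFn A (toReal k)) ^ (3 / 2 : ℝ)) =
      ∫ u in Ioi (minG A), (Ioi (supportFn A (toReal k))).indicator (weight K) u := fun k hk => by
    rw [← (integral_weight (supportFn_pos hA (hS k hk)) hK0).2,
      setIntegral_indicator measurableSet_Ioi, inter_eq_right.2 (Ioi_subset_Ioi (hgk k hk))]
  rw [weightIntegral, ← heq, Finset.sum_congr rfl hk2, ← integral_finsetSum S hk1]
  refine setIntegral_mono_on (integrable_finsetSum S hk1) hint measurableSet_Ioi fun u hu => ?_
  have hu0 : 0 < u := hG.trans hu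
  have h1 : ∑ k ∈ S, (Ioi (supportFn A (toReal k))).indicator (weight K) u =
      weight K u * ((S.filter fun k => supportFn A (toReal k) < u).card : ℝ) := by
    simp only [indicator_apply, mem_Ioi]
    rw [← Finset.sum_filter, Finset.sum_const, nsmul_eq_mul, mul_comm]
  rw [h1]
  refine mul_le_mul_of_nonneg_left (card_le_aFn hA hdet hu0 _ fun k hk => ?_)
    (weight_nonneg hK0 hu0)
  rw [Finset.mem_filter] at hk
  exact ⟨hS k hk.1, hk.2.le⟩

/-! ### The lattice rest -/

theorem volume_frontier_scaledEllipse (hA : A.PosDef) (hdet : A.det = 1) {r : ℝ} (hr : 0 ≤ r) :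
    volume (frontier (scaledEllipse A r)) = 0 :=
  (convex_scaledEllipse hA hdet hr).addHaar_frontier volume

theorem norm_fourier_mul_le (hA : A.PosDef) (hdet : A.det = 1) {R ε K : ℝ} (hR : 0 < R)
    (hε : 0 < ε) (hK : 0 < K) (hKε : K ^ (3 / 2 : ℝ) * (3 * Real.pi * ε ^ (3 / 2 : ℝ)) = 1)
    {k : Fin 2 → ℤ} (hk : k ≠ 0) :
    ‖indicatorFourier (scaledEllipse A ε) (toReal k)‖ *
      ‖indicatorFourier (scaledEllipse A R) (toReal k)‖ ≤
    Real.pi * ε ^ 2 * (R ^ (1 / 2 : ℝ) / 3) * (supportFn A (toReal k) ^ (-(3 / 2) : ℝ) *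
      min 1 ((K / supportFn A (toReal k)) ^ (3 / 2 : ℝ))) := by
  have hg := supportFn_pos hA hk
  have h1 := norm_indicatorFourier_scaledEllipse_le hA hdet hR hg
  have h2 := norm_indicatorFourier_scaledEllipse_le hA hdet hε hg
  have h3 := norm_indicatorFourier_le (scaledEllipse A ε) (toReal k)
  rw [volume_real_scaledEllipse hA hdet hε] at h3
  obtain ⟨g, hgg⟩ : ∃ g, g = supportFn A (toReal k) := ⟨_, rfl⟩
  rw [← hgg] at hg h1 h2 ⊢
  have e1 : ε ^ 2 = ε ^ (1 / 2 : ℝ) * ε ^ (3 / 2 : ℝ) := by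
    rw [← Real.rpow_add hε, ← Real.rpow_natCast]; norm_num
  -- The relation `hKε` says that the area bound and the Bessel bound for the small ellipse agree at
  -- `g = K`.
  have e2 : ε ^ (1 / 2 : ℝ) * g ^ (-(3 / 2) : ℝ) / 3 =
      Real.pi * ε ^ 2 * (K / g) ^ (3 / 2 : ℝ) := by
    rw [Real.div_rpow hK.le hg.le, Real.rpow_neg hg.le, e1]
    linear_combination -(ε ^ (1 / 2 : ℝ) * (g ^ (3 / 2 : ℝ))⁻¹ / 3) * hKε
  have h4 : ‖indicatorFourier (scaledEllipse A ε) (toReal k)‖ ≤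
      Real.pi * ε ^ 2 * min 1 ((K / g) ^ (3 / 2 : ℝ)) := by
    rw [mul_min_of_nonneg _ _ (by positivity), mul_one, ← e2]
    exact le_min h3 h2
  refine (mul_le_mul h4 h1 (norm_nonneg _) (by positivity)).trans (le_of_eq ?_)
  ring

theorem abs_tsum_overlap_scaledEllipse_sub_le (hA : A.PosDef) (hdet : A.det = 1) {R ε K : ℝ}
    (hR : 0 < R) (hε : 0 < ε) (hK : minG A ≤ K)
    (hKε : K ^ (3 / 2 : ℝ) * (3 * Real.pi * ε ^ (3 / 2 : ℝ)) = 1) :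
    |∑' m : Fin 2 → ℤ, overlap (scaledEllipse A ε) (scaledEllipse A R) (toReal m) -
      Real.pi * ε ^ 2 * (Real.pi * R ^ 2)| ≤
    Real.pi * ε ^ 2 * (R ^ (1 / 2 : ℝ) / 3 * weightIntegral A K) := by
  have hK0 := (minG_pos hA hdet).trans_le hK
  let B : (Fin 2 → ℤ) → ℝ := fun k => if k = 0 then 0 else
    Real.pi * ε ^ 2 * (R ^ (1 / 2 : ℝ) / 3) * (supportFn A (toReal k) ^ (-(3 / 2) : ℝ) *
      min 1 ((K / supportFn A (toReal k)) ^ (3 / 2 : ℝ)))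
  have hB0 : 0 ≤ B := fun k => by
    have hg : 0 ≤ supportFn A (toReal k) := Real.sqrt_nonneg _
    simp only [B, Pi.zero_apply]
    split_ifs
    · exact le_rfl
    · have : 0 ≤ min 1 ((K / supportFn A (toReal k)) ^ (3 / 2 : ℝ)) :=
        le_min zero_le_one (by positivity)
      positivity
  have hsum : ∀ S : Finset (Fin 2 → ℤ), ∑ k ∈ S, B k ≤
      Real.pi * ε ^ 2 * (R ^ (1 / 2 : ℝ) / 3 * weightIntegral A K) := fun S => by
    have h1 : ∑ k ∈ S, B k = Real.pi * ε ^ 2 * (R ^ (1 / 2 : ℝ) / 3) *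
        ∑ k ∈ S.filter (· ≠ 0), supportFn A (toReal k) ^ (-(3 / 2) : ℝ) *
          min 1 ((K / supportFn A (toReal k)) ^ (3 / 2 : ℝ)) := by
      rw [Finset.mul_sum, Finset.sum_filter]
      exact Finset.sum_congr rfl fun k _ => by by_cases hk : k = 0 <;> simp [B, hk]
    rw [h1, ← mul_assoc]
    exact mul_le_mul_of_nonneg_left (sum_le_weightIntegral hA hdet hK _ fun k hk =>
      (Finset.mem_filter.1 hk).2) (by positivity)
  have h := abs_tsum_overlap_sub_le (isCompact_scaledEllipse hA hdet hε.le)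
    (isCompact_scaledEllipse hA hdet hR.le) (volume_frontier_scaledEllipse hA hdet hR.le)
    (summable_of_sum_le hB0 hsum) (hB0 0) fun k hk => by
      simpa only [B, if_neg hk] using norm_fourier_mul_le hA hdet hR hε hK0 hKε hk
  rw [volume_real_scaledEllipse hA hdet hε, volume_real_scaledEllipse hA hdet hR] at h
  exact h.trans (Real.tsum_le_of_sum_le hB0 hsum)

theorem weightIntegral_nonneg (hA : A.PosDef) (hdet : A.det = 1) {K : ℝ} (hK : minG A ≤ K) :
    0 ≤ weightIntegral A K := by
  simpa using sum_le_weightIntegral hA hdet hK ∅ (by simp)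

theorem abs_latticeRest_ellipse_le (hA : A.PosDef) (hdet : A.det = 1) {t ε K : ℝ} (ht : 0 < t)
    (hε : 0 < ε) (hK : minG A ≤ K)
    (hKε : K ^ (3 / 2 : ℝ) * (3 * Real.pi * ε ^ (3 / 2 : ℝ)) = 1) :
    |latticeRest (ellipse A) t| ≤
      Real.pi * ((t + ε) ^ 2 - t ^ 2) + (t + ε) ^ (1 / 2 : ℝ) / 3 * weightIntegral A K := by
  have hW := weightIntegral_nonneg hA hdet hK
  have hpi := Real.pi_pos
  have hpe : 0 < Real.pi * ε ^ 2 := by positivity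
  have hvol := volume_real_scaledEllipse hA hdet hε
  rw [latticeRest, abs_le]
  obtain ⟨N, hN⟩ : ∃ N, N = ((latticePoints (ellipse A) t).ncard : ℝ) := ⟨_, rfl⟩
  have hN0 : 0 ≤ N := by rw [hN]; positivity
  have hWt : 0 ≤ (t + ε) ^ (1 / 2 : ℝ) / 3 * weightIntegral A K := by positivity
  constructor
  · rcases lt_or_ge ε t with h | h
    · have h1 := tsum_overlap_le_ncard_mul hA hdet hε h
      have h2 := (abs_le.1 (abs_tsum_overlap_scaledEllipse_sub_le hA hdet (sub_pos.2 h) hε hK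
        hKε)).1
      rw [hvol, ← hN] at h1
      have h3 : (t - ε) ^ (1 / 2 : ℝ) / 3 * weightIntegral A K ≤
          (t + ε) ^ (1 / 2 : ℝ) / 3 * weightIntegral A K := by
        gcongr
        linarith
      have h4 : Real.pi * ε ^ 2 * (Real.pi * (t - ε) ^ 2 -
          (t - ε) ^ (1 / 2 : ℝ) / 3 * weightIntegral A K) ≤ Real.pi * ε ^ 2 * N := by linarith
      have h5 := le_of_mul_le_mul_left h4 hpe
      rw [← hN]
      nlinarith [mul_nonneg hpi.le (sq_nonneg ε)]
    -- No smaller ellipse is available when `t ≤ ε`, but then `πt² ≤ πtε` and nonnegativity of the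
    -- count suffices.
    · rw [← hN]
      nlinarith [mul_le_mul_of_nonneg_left h (mul_pos hpi ht).le, mul_nonneg hpi.le (sq_nonneg ε)]
  · have h1 := ncard_mul_le_tsum_overlap hA hdet ht hε
    have h2 := (abs_le.1 (abs_tsum_overlap_scaledEllipse_sub_le hA hdet (add_pos ht hε) hε hK
      hKε)).2
    rw [hvol, ← hN] at h1
    have h4 : Real.pi * ε ^ 2 * N ≤ Real.pi * ε ^ 2 * (Real.pi * (t + ε) ^ 2 +
        (t + ε) ^ (1 / 2 : ℝ) / 3 * weightIntegral A K) := by linarith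
    have h5 := le_of_mul_le_mul_left h4 hpe
    rw [← hN]
    linarith

/-! ### The constants -/

theorem cConst_bounds : 0.67317 ≤ cConst ∧ cConst < 0.67318 := by
  have h1 := Real.pi_gt_d6
  have h2 := Real.pi_lt_d6
  have hX : 0 < 2823576 / Real.pi ^ 2 := by positivity
  obtain ⟨y, hy⟩ : ∃ y, y = (2823576 / Real.pi ^ 2) ^ (1 / 9 : ℝ) := ⟨_, rfl⟩
  have hy0 : 0 ≤ y := by rw [hy]; positivity
  have hy9 : y ^ 9 = 2823576 / Real.pi ^ 2 := by
    rw [hy, ← Real.rpow_natCast, ← Real.rpow_mul hX.le]; norm_num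
  -- The bounds for `y = 6c` are `6 · 0.67317` and `6 · 0.67318`, checked on ninth powers.
  have hl : (4.03902 : ℝ) ≤ y := by
    refine le_of_pow_le_pow_left₀ (n := 9) (by norm_num) hy0 ?_
    rw [hy9, le_div_iff₀ (by positivity)]
    calc (4.03902 : ℝ) ^ 9 * Real.pi ^ 2 ≤ 4.03902 ^ 9 * 3.141593 ^ 2 := by gcongr
      _ ≤ _ := by norm_num
  have hu : y < 4.03908 := by
    refine lt_of_pow_lt_pow_left₀ 9 (by norm_num) ?_
    rw [hy9, div_lt_iff₀ (by positivity)]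
    calc (2823576 : ℝ) < 4.03908 ^ 9 * 3.141592 ^ 2 := by norm_num
      _ ≤ _ := by gcongr
  rw [cConst, ← hy]
  constructor <;> linarith

theorem cConst_pos : 0 < cConst := lt_of_lt_of_le (by norm_num) cConst_bounds.1

theorem eps_pos {t : ℝ} (ht : 0 < t) : 0 < eps t := div_pos cConst_pos (by positivity)

theorem bigK_pos {t : ℝ} (ht : 0 < t) : 0 < bigK t :=
  mul_pos (by positivity) (inv_pos.2 (eps_pos ht))

theorem bigK_rpow_mul {t : ℝ} (ht : 0 < t) :
    bigK t ^ (3 / 2 : ℝ) * (3 * Real.pi * eps t ^ (3 / 2 : ℝ)) = 1 := by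
  have he := eps_pos ht
  have hpi := Real.pi_pos
  rw [bigK, Real.mul_rpow (by positivity) (by positivity), ← Real.rpow_mul (by positivity),
    Real.inv_rpow he.le, show -(2 / 3) * (3 / 2) = (-1 : ℝ) by norm_num, Real.rpow_neg_one]
  have : eps t ^ (3 / 2 : ℝ) ≠ 0 := by positivity
  field_simp

/-- Cubing, `G ≤ K` means `c³ (3π)² G³ ≤ t`; the factor `c³ (3π)²` is about 27.1, hence the
threshold 28. -/
theorem le_bigK {t G : ℝ} (hG : 0 < G) (ht : 28 * G ^ 3 ≤ t) : G ≤ bigK t := by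
  have ht0 : 0 < t := lt_of_lt_of_le (by positivity) ht
  have hc := cConst_pos
  have hpi := Real.pi_pos
  refine le_of_pow_le_pow_left₀ (n := 3) (by norm_num) (bigK_pos ht0).le ?_
  have e1 : ((3 * Real.pi) ^ (-(2 / 3) : ℝ)) ^ 3 = ((3 * Real.pi) ^ 2)⁻¹ := by
    rw [← Real.rpow_natCast, ← Real.rpow_mul (by positivity), ← Real.rpow_natCast,
      ← Real.rpow_neg (by positivity)]
    norm_num
  have e2 : (t ^ (1 / 3 : ℝ)) ^ 3 = t := by
    rw [← Real.rpow_natCast, ← Real.rpow_mul ht0.le]; norm_num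
  rw [bigK, eps, mul_pow, e1, inv_pow, div_pow, e2, inv_div, ← div_eq_inv_mul, div_div,
    le_div_iff₀ (by positivity)]
  have h1 : cConst ^ 3 * (3 * Real.pi) ^ 2 ≤ 28 := by
    calc cConst ^ 3 * (3 * Real.pi) ^ 2 ≤ 0.67318 ^ 3 * (3 * 3.1416) ^ 2 := by
          gcongr
          · exact cConst_bounds.2.le
          · exact Real.pi_lt_d4.le
      _ ≤ 28 := by norm_num
  calc G ^ 3 * (cConst ^ 3 * (3 * Real.pi) ^ 2) ≤ G ^ 3 * 28 := by gcongr
    _ ≤ t := by linarith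

/-! ### The unit disc -/

theorem quadForm_one (x : Fin 2 → ℝ) : quadForm 1 x = x 0 ^ 2 + x 1 ^ 2 := by
  simp [quadForm_apply]

theorem ellipse_one : ellipse 1 = unitDisc := by
  ext x
  simp [ellipse, unitDisc, quadForm_one]

theorem supportFn_one (x : Fin 2 → ℝ) : supportFn 1 x = √(x 0 ^ 2 + x 1 ^ 2) := by
  rw [supportFn, inv_one, quadForm_one]

theorem minG_one : minG 1 = 1 := by
  have h : IsLeast (latticeValues 1) 1 := by
    refine ⟨⟨![1, 0], fun h => one_ne_zero (congrFun h 0), ?_⟩, ?_⟩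
    · simp [supportFn_one, toReal]
    · rintro _ ⟨k, hk, rfl⟩
      rw [supportFn_one, Real.one_le_sqrt]
      have h1 : 0 < k 0 ^ 2 + k 1 ^ 2 := by
        by_contra hneg
        refine hk (funext fun i => ?_)
        fin_cases i
        · change k 0 = 0
          nlinarith [sq_nonneg (k 0), sq_nonneg (k 1)]
        · change k 1 = 0
          nlinarith [sq_nonneg (k 0), sq_nonneg (k 1)]
      have h2 : 1 ≤ k 0 ^ 2 + k 1 ^ 2 := h1
      simp only [toReal]
      exact_mod_cast h2
  rw [minG, h.csInf_eq]

theorem maxG_one : maxG 1 = √(1 / 2) := by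
  have h : IsGreatest (squareValues 1) (√(1 / 2)) := by
    refine ⟨⟨fun _ => 1 / 2, fun _ => by norm_num, ?_⟩, ?_⟩
    · rw [supportFn_one]; norm_num
    · rintro _ ⟨w, hw, rfl⟩
      rw [supportFn_one]
      refine Real.sqrt_le_sqrt ?_
      have h0 := hw 0
      have h1 := hw 1
      nlinarith [mul_nonneg (sub_nonneg.2 h0.1) (sub_nonneg.2 h0.2),
        mul_nonneg (sub_nonneg.2 h1.1) (sub_nonneg.2 h1.2)]
  rw [maxG, h.csSup_eq]

theorem weightIntegral_one_le {K : ℝ} (hK : 1 ≤ K) :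
    weightIntegral 1 K / 3 ≤ 2 * Real.pi * K ^ (1 / 2 : ℝ) + 1.492 := by
  have hK0 : 0 < K := zero_lt_one.trans_le hK
  have hpi := Real.pi_pos
  have hG : √(1 / 2 : ℝ) ≤ 0.7072 := Real.sqrt_le_iff.2 ⟨by norm_num, by norm_num⟩
  have hG2 : √(1 / 2 : ℝ) ^ 2 = 1 / 2 := Real.sq_sqrt (by norm_num)
  have hmul : ∀ a b : ℝ, K ^ a * K ^ b = K ^ (a + b) := fun a b => (Real.rpow_add hK0 a b).symm
  have e1 : K ^ (3 / 2 : ℝ) * K ^ (-1 : ℝ) = K ^ (1 / 2 : ℝ) := by rw [hmul]; norm_num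
  have e2 : K ^ (3 / 2 : ℝ) * K ^ (-2 : ℝ) = K ^ (-(1 / 2) : ℝ) := by rw [hmul]; norm_num
  have e3 : K ^ (3 / 2 : ℝ) * K ^ (-3 : ℝ) = K ^ (-(3 / 2) : ℝ) := by rw [hmul]; norm_num
  have hp : 0 ≤ Real.pi * √(1 / 2) * K ^ (-(1 / 2) : ℝ) := by positivity
  rw [weightIntegral, minG_one, (integral_rpow_mul_aFn 1 one_pos hK).2,
    (integral_Ioi_rpow_mul_aFn 1 hK0).2, maxG_one, hG2]
  simp only [Real.one_rpow]
  have hc : Real.pi * (2 * √(1 / 2) - 5 / 6) - 1 / 3 ≤ 1.492 := by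
    nlinarith [Real.pi_lt_d4, Real.pi_gt_d4]
  -- The `K^(-3/2)` terms cancel, and the `K^(-1/2)` terms leave a nonpositive remainder, discarded
  -- through `hp`.
  linear_combination Real.pi * e1 + Real.pi * √(1 / 2) * e2 + (Real.pi / 2 - 1) / 3 * e3 + hc + hp

theorem abs_latticeRest_unitDisc_le {t : ℝ} (ht : 28 ≤ t) :
    |latticeRest unitDisc t| ≤
      8.46 * t ^ (2 / 3 : ℝ) + 1.5 * t ^ (1 / 2 : ℝ) + 1 + 3 / t ^ (1 / 3 : ℝ)
        + 2.85 / t ^ (2 / 3 : ℝ) + 0.51 / t ^ (5 / 6 : ℝ) + 0.34 / t ^ (4 / 3 : ℝ) := by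
  have ht0 : 0 < t := by linarith
  have hK : 1 ≤ bigK t := le_bigK one_pos (by linarith)
  have h := abs_latticeRest_ellipse_le (A := 1) Matrix.PosDef.one Matrix.det_one ht0 (eps_pos ht0)
    (by rw [minG_one]; exact hK) (bigK_rpow_mul ht0)
  rw [ellipse_one] at h
  refine h.trans ?_
  -- All exponents of `t` are multiples of `1/6`, so everything becomes rational in `s`.
  obtain ⟨s, hs⟩ : ∃ s, s = t ^ (1 / 6 : ℝ) := ⟨_, rfl⟩
  have hs0 : 0 < s := by rw [hs]; positivity
  have hpow : ∀ (n : ℕ), t ^ ((n : ℝ) / 6) = s ^ n := fun n => by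
    rw [hs, ← Real.rpow_natCast, ← Real.rpow_mul ht0.le]; congr 1; ring
  have p2 : t ^ (1 / 3 : ℝ) = s ^ 2 := by rw [← hpow]; norm_num
  have p3 : t ^ (1 / 2 : ℝ) = s ^ 3 := by rw [← hpow]; norm_num
  have p4 : t ^ (2 / 3 : ℝ) = s ^ 4 := by rw [← hpow]; norm_num
  have p5 : t ^ (5 / 6 : ℝ) = s ^ 5 := by rw [← hpow]; norm_num
  have p6 : t = s ^ 6 := by rw [← hpow]; norm_num
  have p8 : t ^ (4 / 3 : ℝ) = s ^ 8 := by rw [← hpow]; norm_num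
  have hc := cConst_pos
  have hc1 := cConst_bounds.1
  have hc2 := cConst_bounds.2
  have hpi := Real.pi_pos
  have hpi2 := Real.pi_lt_d4
  have he : eps t = cConst / s ^ 2 := by rw [eps, p2]
  have hKs : bigK t ^ (1 / 2 : ℝ) ≤ 0.58 * s := by
    have e1 : ((3 * Real.pi) ^ (-(2 / 3) : ℝ)) ^ 3 = ((3 * Real.pi) ^ 2)⁻¹ := by
      rw [← Real.rpow_natCast, ← Real.rpow_mul (by positivity), ← Real.rpow_natCast,
        ← Real.rpow_neg (by positivity)]
      norm_num
    have hκ : (3 * Real.pi) ^ (-(2 / 3) : ℝ) ≤ 0.2264 := by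
      refine le_of_pow_le_pow_left₀ (n := 3) (by norm_num) (by norm_num) ?_
      rw [e1]
      refine inv_le_of_inv_le₀ (by norm_num) ?_
      calc ((0.2264 : ℝ) ^ 3)⁻¹ ≤ (3 * 3.1415) ^ 2 := by norm_num
        _ ≤ (3 * Real.pi) ^ 2 := by gcongr; exact Real.pi_gt_d4.le
    rw [← Real.sqrt_eq_rpow]
    refine Real.sqrt_le_iff.2 ⟨by positivity, ?_⟩
    rw [bigK, he, inv_div, ← mul_div_assoc, div_le_iff₀ hc]
    nlinarith [sq_pos_of_pos hs0, mul_le_mul_of_nonneg_right hκ (sq_pos_of_pos hs0).le,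
      mul_le_mul_of_nonneg_right hc1 (sq_pos_of_pos hs0).le]
  -- The tangent bound `√(t + ε) ≤ √t + ε/(2√t)`.
  have hR : (t + eps t) ^ (1 / 2 : ℝ) ≤ s ^ 3 + cConst / (2 * s ^ 5) := by
    rw [← Real.sqrt_eq_rpow]
    refine Real.sqrt_le_iff.2 ⟨by positivity, ?_⟩
    have e : (s ^ 3 + cConst / (2 * s ^ 5)) ^ 2 =
        s ^ 6 + cConst / s ^ 2 + (cConst / (2 * s ^ 5)) ^ 2 := by
      field_simp; ring
    rw [he, e, ← p6]
    linarith [sq_nonneg (cConst / (2 * s ^ 5))]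
  have hW : weightIntegral 1 (bigK t) / 3 ≤ 3.65 * s + 1.492 := by
    refine (weightIntegral_one_le hK).trans ?_
    have : 2 * Real.pi * bigK t ^ (1 / 2 : ℝ) ≤ 2 * 3.1416 * (0.58 * s) := by gcongr
    linarith
  have hmain : (t + eps t) ^ (1 / 2 : ℝ) / 3 * weightIntegral 1 (bigK t) ≤
      (s ^ 3 + cConst / (2 * s ^ 5)) * (3.65 * s + 1.492) := by
    rw [div_mul_eq_mul_div, mul_div_assoc]
    have := weightIntegral_nonneg (A := 1) Matrix.PosDef.one Matrix.det_one
      (minG_one.trans_le hK)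
    gcongr
  have e1 : Real.pi * ((t + eps t) ^ 2 - t ^ 2) + (s ^ 3 + cConst / (2 * s ^ 5)) *
      (3.65 * s + 1.492) = (2 * Real.pi * cConst + 3.65) * s ^ 4 + 1.492 * s ^ 3 +
      (Real.pi * cConst ^ 2 + 3.65 * cConst / 2) / s ^ 4 + 1.492 * cConst / 2 / s ^ 5 := by
    rw [he, p6]; field_simp; ring
  have c1 : Real.pi * cConst ≤ 3.1416 * 0.67318 := by gcongr
  have c2 : Real.pi * cConst ^ 2 ≤ 3.1416 * 0.67318 ^ 2 := by gcongr
  rw [p2, p3, p4, p5, p8]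
  calc _ ≤ _ := add_le_add le_rfl hmain
    _ = _ := e1
    -- The leading coefficient `2πc + 3.65` is below 7.9, so 8.46 leaves ample room.
    _ ≤ 8.46 * s ^ 4 + 1.5 * s ^ 3 + 2.85 / s ^ 4 + 0.51 / s ^ 5 := by
      gcongr
      · linarith
      · norm_num
      · norm_num at c2 ⊢; linarith
      · linarith
    _ ≤ _ := by
      have h1 : 0 ≤ 3 / s ^ 2 := by positivity
      have h2 : 0 ≤ 0.34 / s ^ 8 := by positivity
      linarith

theorem finite_latticePoints_ellipse (hA : A.PosDef)
    (hdet : A.det = 1) {t : ℝ} (ht : 0 < t) : (latticePoints (ellipse A) t).Finite := by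
  rw [latticePoints_ellipse ht]
  exact finite_toReal_mem_scaledEllipse hA hdet ht.le

theorem abs_latticeRest_ellipse_le_of_le (hA : A.PosDef)
    (hdet : A.det = 1) {t : ℝ} (ht : 28 * minG A ^ 3 ≤ t) :
    |latticeRest (ellipse A) t| ≤ Real.pi * ((t + eps t) ^ 2 - t ^ 2)
      + (t + eps t) ^ (1 / 2 : ℝ) / (3 * bigK t ^ (3 / 2 : ℝ)) * aFn A (bigK t)
      + (t + eps t) ^ (1 / 2 : ℝ) / 2 *
        (∫ u in (minG A)..(bigK t), u ^ (-(5 / 2) : ℝ) * aFn A u)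
      + (t + eps t) ^ (1 / 2 : ℝ) / (3 * Real.pi * eps t ^ (3 / 2 : ℝ)) *
        (∫ u in Ioi (bigK t), u ^ (-4 : ℝ) * aFn A u) := by
  have hG := minG_pos hA hdet
  have ht0 : 0 < t := lt_of_lt_of_le (by positivity) ht
  have hK0 := bigK_pos ht0
  have he := eps_pos ht0
  have hpi := Real.pi_pos
  have hKe := bigK_rpow_mul ht0
  refine (abs_latticeRest_ellipse_le hA hdet ht0 he (le_bigK hG ht) hKe).trans ?_
  have h1 : 0 ≤ (t + eps t) ^ (1 / 2 : ℝ) / (3 * bigK t ^ (3 / 2 : ℝ)) * aFn A (bigK t) :=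
    mul_nonneg (by positivity) (aFn_nonneg hA hdet hK0)
  have h2 : (t + eps t) ^ (1 / 2 : ℝ) / (3 * Real.pi * eps t ^ (3 / 2 : ℝ)) =
      (t + eps t) ^ (1 / 2 : ℝ) * bigK t ^ (3 / 2 : ℝ) := by
    rw [div_eq_iff (by positivity), mul_assoc, hKe, mul_one]
  rw [h2, weightIntegral]
  linarith

end EllipseRest

end

/-- Attainment, finiteness and integrability are asserted so that `sInf`, `sSup`, `ncard` and the
integrals do not take default values. -/
theorem mainTheorem3 :
    (0.67317 ≤ EllipseRest.cConst ∧ EllipseRest.cConst < 0.67318) ∧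
    (∀ A : Matrix (Fin 2) (Fin 2) ℝ, A.PosDef → A.det = 1 →
      IsLeast (EllipseRest.latticeValues A) (EllipseRest.minG A) ∧
      IsGreatest (EllipseRest.squareValues A) (EllipseRest.maxG A) ∧
      ∀ t : ℝ, 28 * EllipseRest.minG A ^ 3 ≤ t →
        (EllipseRest.latticePoints (EllipseRest.ellipse A) t).Finite ∧
        IntervalIntegrable (fun u : ℝ => u ^ (-(5 / 2) : ℝ) * EllipseRest.aFn A u)
          MeasureTheory.volume (EllipseRest.minG A) (EllipseRest.bigK t) ∧
        MeasureTheory.IntegrableOn (fun u : ℝ => u ^ (-4 : ℝ) * EllipseRest.aFn A u)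
          (Set.Ioi (EllipseRest.bigK t)) ∧
        |EllipseRest.latticeRest (EllipseRest.ellipse A) t| ≤
          Real.pi * ((t + EllipseRest.eps t) ^ 2 - t ^ 2)
          + (t + EllipseRest.eps t) ^ (1 / 2 : ℝ) / (3 * EllipseRest.bigK t ^ (3 / 2 : ℝ))
              * EllipseRest.aFn A (EllipseRest.bigK t)
          + (t + EllipseRest.eps t) ^ (1 / 2 : ℝ) / 2
              * (∫ u in (EllipseRest.minG A)..(EllipseRest.bigK t),
                  u ^ (-(5 / 2) : ℝ) * EllipseRest.aFn A u)
          + (t + EllipseRest.eps t) ^ (1 / 2 : ℝ)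
                / (3 * Real.pi * EllipseRest.eps t ^ (3 / 2 : ℝ))
              * (∫ u in Set.Ioi (EllipseRest.bigK t),
                  u ^ (-4 : ℝ) * EllipseRest.aFn A u)) ∧
    (∀ t : ℝ, 28 ≤ t →
      (EllipseRest.latticePoints EllipseRest.unitDisc t).Finite ∧
      |EllipseRest.latticeRest EllipseRest.unitDisc t| ≤
        8.46 * t ^ (2 / 3 : ℝ) + 1.5 * t ^ (1 / 2 : ℝ) + 1 + 3 / t ^ (1 / 3 : ℝ)
          + 2.85 / t ^ (2 / 3 : ℝ) + 0.51 / t ^ (5 / 6 : ℝ) + 0.34 / t ^ (4 / 3 : ℝ)) :=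
  ⟨EllipseRest.cConst_bounds, fun A hA hdet =>
    ⟨EllipseRest.isLeast_minG hA hdet, EllipseRest.isGreatest_maxG A, fun t ht =>
      have hG := EllipseRest.minG_pos hA hdet
      have ht0 : 0 < t := lt_of_lt_of_le (by positivity) ht
      ⟨EllipseRest.finite_latticePoints_ellipse hA hdet ht0,
        (EllipseRest.integral_rpow_mul_aFn A hG (EllipseRest.le_bigK hG ht)).1,
        (EllipseRest.integral_Ioi_rpow_mul_aFn A (EllipseRest.bigK_pos ht0)).1,
        EllipseRest.abs_latticeRest_ellipse_le_of_le hA hdet ht⟩⟩,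
    fun t ht =>
      ⟨EllipseRest.ellipse_one ▸ EllipseRest.finite_latticePoints_ellipse Matrix.PosDef.one
        Matrix.det_one (lt_of_lt_of_le (by norm_num) ht),
        EllipseRest.abs_latticeRest_unitDisc_le ht⟩⟩
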